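/- Let $\mathbb{H}=\{\tau=u+iv: v>0\}$ and $\Gamma=\mathrm{SL}_2(\mathbb{Z})$. For $\mathrm{Re}(s)>1$ let \[ E_{1,0}(\tau,s)=\sum_{\gamma\in\Gamma_\infty\backslash\Gamma}\mathrm{Im}(\gamma\tau)^s ,\qquad \Gamma_\infty=\{\pm\begin{pmatrix}1&n\\0&1\end{pmatrix}: n\in\mathbb{Z}\}, \] and let $E_{1,0}(\tau,s)$ also denote its meromorphic continuation to $s\in\mathbb{C}$. Let $f$ be a meromorphic modular form of weight $0$ on $\Gamma$, i.e. a $\Gamma$-invariant function that is meromorphic on $\mathbb{H}$ and at the cusp $i\infty$, with $f(i\infty)=\lim_{\tau\to i\infty}f(\tau)=1$. For $z\in\mathbb{H}$ let $\mathrm{ord}_z(f)$ be the order of $f$ at $z$ and let $\omega_z$ be the order of the stabilizer of $z$ in $\mathrm{PSL}_2(\mathbb{Z})=\Gamma/\{\pm I\}$. Let $\mathcal{F}\subset\mathbb{H}$ be a closed fundamental domain for $\Gamma$: $\mathcal{F}$ is closed, its translates cover $\mathbb{H}$, and $\mathcal{F}\cap\gamma^{-1}\mathcal{F}$ has measure zero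 for $\gamma\in\Gamma$, $\gamma\ne\pm I$. For $\varepsilon,y>0$ let $\mathcal{F}^{\varepsilon,y}$ be obtained from $\mathcal{F}$ by removing the Euclidean discs $\{|\tau-z|<\varepsilon\}$ around all zeros and poles $z\in\mathcal{F}$ of $f$, and the neighbourhoods $\{\sigma_\rho\tau:\mathrm{Im}(\tau)>y\}$ ($\sigma_\rho\in\Gamma$, $\sigma_\rho i\infty=\rho$) of all cusps $\rho\in\mathbb{Q}\cup\{i\infty\}$ of $\mathcal{F}$, i.e. of those $\rho$ all of whose neighbourhoods $\{\sigma_\rho\tau:\mathrm{Im}(\tau)>y\}$ meet $\mathcal{F}$. Put \[ \langle E_{1,0}(\cdot,s),\log|f|\rangle^{\mathrm{reg}}=\lim_{\varepsilon\to0^+}\ \lim_{y\to\infty}\int_{\mathcal{F}^{\varepsilon,y}}E_{1,0}(\tau,s)\,\overline{\log|f(\tau)|}\,\frac{du\,dv}{v^2}. \] Let $s\in\mathbb{C}$ satisfy $\mathrm{Re}(s)>1$ or, more generally, let $s$ be a point at which $E_{1,0}(\tau,\cdot)$ is holomorphic for every $\tau\in\mathbb{H}$. Then only finitely many $z\in\Gamma\backslash\mathbb{H}$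 have $\mathrm{ord}_z(f)\neq0$, the above limits exist, and \[ s(1-s)\,\langle E_{1,0}(\cdot,s),\log|f|\rangle^{\mathrm{reg}}=-2\pi\sum_{z\in\Gamma\backslash\mathbb{H}}\frac{\mathrm{ord}_z(f)}{\omega_z}\,E_{1,0}(z,s). \] -/

import Mathlib

open Filter Topology MeasureTheory UpperHalfPlane
open scoped MatrixGroups ModularForm OnePoint

noncomputable section

namespace EisensteinDivisorSum

/-! ### Meromorphic modular forms on `SL₂(ℤ)` -/

/-- `f` is a meromorphic modular form of weight `k` on `SL₂(ℤ)`: it is meromorphic on `ℍ`, invariant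
under the weight `k` slash action, and meromorphic at the cusp `i∞`, that is, as a function of
`q = exp (2πiτ)` it is meromorphic at `q = 0`. (All cusps of `SL₂(ℤ)` are equivalent to `i∞`.) -/
structure IsMeromorphicModularForm (k : ℤ) (f : ℍ → ℂ) : Prop where
  meromorphicOn : MeromorphicOn (f ∘ ofComplex) {z : ℂ | 0 < z.im}
  slash_eq : ∀ γ : SL(2, ℤ), f ∣[k] γ = f
  meromorphicAt_cusp : MeromorphicAt (UpperHalfPlane.cuspFunction 1 f) 0

/-- The order `ord_z(f)` of a meromorphic function `f` on `ℍ` at `z`. -/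
def ordAt (f : ℍ → ℂ) (z : ℍ) : ℤ :=
  (meromorphicOrderAt (f ∘ ofComplex) (z : ℂ)).untop₀

/-- `ω_z`, the order of the stabilizer of `z` in `PSL₂(ℤ) = SL₂(ℤ) / {±1}`. -/
def omega (z : ℍ) : ℕ :=
  Nat.card ((MulAction.stabilizer SL(2, ℤ) z).map
    (QuotientGroup.mk' (Subgroup.center SL(2, ℤ))))

/-! ### The weight `0` Eisenstein series -/

/-- `Γ_∞`, the stabilizer of the cusp `i∞` in `SL₂(ℤ)`. -/
def GammaInf : Subgroup SL(2, ℤ) :=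
  (MulAction.stabilizer (GL (Fin 2) ℚ) (∞ : OnePoint ℚ)).comap
    (Matrix.SpecialLinearGroup.mapGL ℚ)

lemma im_smul_of_mem_GammaInf {γ : SL(2, ℤ)} (hγ : γ ∈ GammaInf) (τ : ℍ) :
    (γ • τ).im = τ.im := by
  have h : γ 1 0 = 0 := by
    have h1 := hγ
    rw [GammaInf, Subgroup.mem_comap, MulAction.mem_stabilizer_iff,
      OnePoint.smul_infty_eq_self_iff] at h1
    simpa using h1
  obtain ⟨n, hn⟩ := ModularGroup.exists_eq_T_zpow_of_c_eq_zero h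
  rw [hn τ, ModularGroup.im_T_zpow_smul]

/-- `Im (γτ)`, as a function of the coset `Γ_∞ γ` in `Γ_∞ \ SL₂(ℤ)`. -/
def cosetIm (τ : ℍ) : Quotient (QuotientGroup.rightRel GammaInf) → ℝ :=
  Quotient.lift (fun γ : SL(2, ℤ) => (γ • τ).im) (by
    intro a b hab
    have hab' : b * a⁻¹ ∈ GammaInf := QuotientGroup.rightRel_apply.mp hab
    have h := im_smul_of_mem_GammaInf hab' (a • τ)
    rw [smul_smul, inv_mul_cancel_right] at h
    exact h.symm)

/-- The series `∑_{γ ∈ Γ_∞ \ SL₂(ℤ)} Im(γτ)^s`, which converges for `Re s > 1`. -/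
def eisensteinSeries (τ : ℍ) (s : ℂ) : ℂ :=
  ∑' c : Quotient (QuotientGroup.rightRel GammaInf), ((cosetIm τ c : ℝ) : ℂ) ^ s

open Classical in
/-- The meromorphic continuation to `ℂ` of a function `F` that is given on the set `U`. For open
non-empty `U` it is unique if it exists, because of the normal form, which fixes the values at the
poles (as `0`) and removes all removable singularities. If there is none, the value is `F`. -/
def meromorphicContinuation (U : Set ℂ) (F : ℂ → ℂ) : ℂ → ℂ :=
  if h : ∃ G : ℂ → ℂ, MeromorphicNFOn G Set.univ ∧ Set.EqOn G F U then h.choose else F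

lemma meromorphicContinuation_eqOn (U : Set ℂ) (F : ℂ → ℂ) :
    Set.EqOn (meromorphicContinuation U F) F U := by
  unfold meromorphicContinuation
  split_ifs with h
  · exact h.choose_spec.2
  · exact fun _ _ => rfl

/-- The Eisenstein series `E_{1,0}(τ, s)`: the above series for `Re s > 1`, and its meromorphic
continuation in `s` elsewhere. -/
def eisenstein (τ : ℍ) : ℂ → ℂ :=
  meromorphicContinuation {s : ℂ | 1 < s.re} (eisensteinSeries τ)

/-! ### The regularized Petersson inner product -/

/-- `F = 𝓕 ∩ ℍ` for a closed fundamental domain `𝓕` of `SL₂(ℤ)`: closed, its translates cover `ℍ`,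
and translates by elements that differ in `PSL₂(ℤ)` overlap in a set of measure zero only. -/
structure IsClosedFundamentalDomain (F : Set ℍ) : Prop where
  isClosed : IsClosed F
  covers : ∀ τ : ℍ, ∃ γ : SL(2, ℤ), γ • τ ∈ F
  overlap : ∀ γ : SL(2, ℤ), γ ≠ 1 → γ ≠ -1 → volume {τ : ℍ | τ ∈ F ∧ γ • τ ∈ F} = 0

/-- The neighbourhood `{σ τ : Im τ > y}` of the cusp `ρ = σ(i∞)`. -/
def cuspNhd (ρ : OnePoint ℚ) (y : ℝ) : Set ℍ :=
  {τ | ∃ σ : SL(2, ℤ), Matrix.SpecialLinearGroup.mapGL ℚ σ • (∞ : OnePoint ℚ) = ρ ∧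
    y < (σ⁻¹ • τ).im}

/-- The cusps of `F`: those in its closure in `ℍ ∪ ℚ ∪ {i∞}`. -/
def cuspsOf (F : Set ℍ) : Set (OnePoint ℚ) :=
  {ρ | ∀ y : ℝ, (cuspNhd ρ y ∩ F).Nonempty}

/-- The punctured fundamental domain: remove from `F` the (Euclidean) `ε`-neighbourhoods of the
points of `S` in `F` and the `y`-neighbourhoods of the cusps of `F`. -/
def puncturedDomain (F S : Set ℍ) (ε y : ℝ) : Set ℍ :=
  F \ ((⋃ z ∈ S ∩ F, {τ : ℍ | ‖(τ : ℂ) - (z : ℂ)‖ < ε}) ∪ ⋃ ρ ∈ cuspsOf F, cuspNhd ρ y)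

/-- The regularized Petersson inner product `⟨f, g⟩^reg`, formed with the fundamental domain `F` and
the set `S` of singularities of `f` and `g`, exists and equals `L`:
`lim_{ε → 0} lim_{y → ∞} ∫_{F^{ε,y}} f(τ) conj(g(τ)) du dv / v² = L`.
The measure `volume` on `ℍ` is `du dv / v²`. -/
def HasRegInner (F S : Set ℍ) (f g : ℍ → ℂ) (L : ℂ) : Prop :=
  ∃ I : ℝ → ℂ,
    (∀ᶠ ε in 𝓝[>] (0 : ℝ),
      (∀ᶠ y in atTop,
        IntegrableOn (fun τ => f τ * starRingEnd ℂ (g τ)) (puncturedDomain F S ε y) volume) ∧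
      Tendsto (fun y : ℝ =>
        ∫ τ in puncturedDomain F S ε y, f τ * starRingEnd ℂ (g τ)) atTop (𝓝 (I ε))) ∧
    Tendsto I (𝓝[>] (0 : ℝ)) (𝓝 L)

end EisensteinDivisorSum

end

open Filter Topology MeasureTheory UpperHalfPlane
open scoped MatrixGroups ModularForm OnePoint

noncomputable section

namespace EisensteinDivisorSum

/-! For Re s > 1 this is Rankin–Selberg unfolding followed by Jensen's formula, with no Laplacian or
Stokes argument. Written as a sum over all transformations that carry τ into the strip 0 ≤ Re < 1
(`hasSum_coset_iff`), the Eisenstein series turns the integral over F into ∫ v^(s-2) (∫ log|f(u+iv)|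
du) dv over 0 < v, 0 ≤ u < 1 (`integral_eisenstein_mul`, `integral_stripPow_mul`). The inner
integral is the average of log|f| over the circle |q| = e^(-2πv). As f = 1 at q = 0, Jensen
evaluates it as 2π ∑ ord_z(f) max(Im z - v, 0) over z in the strip (`integral_log_norm`). The Mellin
integral of max(y - v, 0) is y^s / (s(s-1)) (`integral_cpow_mul_max`), and sorting the points of the
strip by orbits reassembles the values E(z, s) / ω_z (`tsum_fiber`).

For other s, Poisson summation gives a functional equation for the theta function of the form
|mτ+n|² / Im τ, and its Mellin transform is the completed Eisenstein series. Hence E = `eisNum` /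
`eisDen`, with entire numerator and denominator, the latter independent of τ (`eisenstein_eq_div`).
For bounded s the numerator is at most a constant times the invariant function `pairSum τ k`
(`exists_norm_eisNum_le`). This grows polynomially at the cusp while log|f| decays exponentially and
is locally integrable, so their product is integrable over F (`integrableOn_pairSum_mul`). The
identity with denominators cleared is thus one of entire functions, and the identity theorem proves
it everywhere (`integral_eisNum`). At a zero of `eisDen` where every E is still holomorphic, the
maximum principle keeps the domination uniform near the point and the identity survives the limit
(`integral_eisenstein_of_analyticAt`).

The same domination makes the integral over F absolutely convergent, so the regularizing limits
return the plain integral (`hasRegInner_of_integrableOn`). -/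

/-! ### The modular group as a group of transformations -/

/-- The group of transformations of `ℍ` induced by `SL₂(ℤ)`. -/
abbrev modularAut : Subgroup (Equiv.Perm ℍ) := (MulAction.toPermHom SL(2, ℤ) ℍ).range

/-- The transformation of `ℍ` induced by an element of `SL₂(ℤ)`. -/
def toAut : SL(2, ℤ) →* modularAut := (MulAction.toPermHom SL(2, ℤ) ℍ).rangeRestrict

@[simp] lemma toAut_smul (γ : SL(2, ℤ)) (τ : ℍ) : toAut γ • τ = γ • τ := rfl

lemma toAut_surjective : Function.Surjective toAut := MonoidHom.rangeRestrict_surjective _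

lemma eq_one_or_neg_one_of_forall_smul_eq {γ : SL(2, ℤ)} (h : ∀ τ : ℍ, γ • τ = τ) :
    γ = 1 ∨ γ = -1 := by
  -- The test point 2i is interior to the standard domain, where only ±1 can relate two points.
  have hz : (⟨⟨0, 2⟩, by norm_num⟩ : ℍ) ∈ ModularGroup.fdo := by
    simp only [ModularGroup.fdo, Set.mem_ofPred_eq, Complex.normSq_mk, UpperHalfPlane.re]
    norm_num
  exact ModularGroup.eq_one_or_neg_one_of_mem_fdo_mem_fdo hz (by rwa [h])

lemma toAut_eq_one_iff {γ : SL(2, ℤ)} : toAut γ = 1 ↔ γ = 1 ∨ γ = -1 := by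
  constructor
  · intro h
    refine eq_one_or_neg_one_of_forall_smul_eq fun τ => ?_
    rw [← toAut_smul, h, one_smul]
  · rintro (rfl | rfl)
    · exact map_one _
    · ext τ : 2
      exact (ModularGroup.SL_neg_smul 1 τ).trans (one_smul _ τ)

lemma toAut_eq_iff {γ γ' : SL(2, ℤ)} : toAut γ = toAut γ' ↔ γ = γ' ∨ γ = -γ' := by
  rw [← mul_inv_eq_one, ← map_inv, ← map_mul, toAut_eq_one_iff, mul_inv_eq_one,
    mul_inv_eq_iff_eq_mul, neg_one_mul]

instance : Countable SL(2, ℤ) :=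
  inferInstanceAs (Countable {A : Fin 2 → Fin 2 → ℤ // Matrix.det A = 1})

instance : Countable modularAut := toAut_surjective.countable

instance : ContinuousConstSMul SL(2, ℤ) ℍ where
  continuous_const_smul γ :=
    continuous_const_smul (Matrix.SpecialLinearGroup.map (Int.castRingHom ℝ) γ : SL(2, ℝ))

instance : ContinuousConstSMul modularAut ℍ where
  continuous_const_smul p := by
    obtain ⟨γ, rfl⟩ := toAut_surjective p
    exact continuous_const_smul γ

instance : SMulInvariantMeasure SL(2, ℤ) ℍ volume where
  measure_preimage_smul γ _ ht :=
    measure_preimage_smul_of_nullMeasurableSet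
      (ht.nullMeasurableSet) (Matrix.SpecialLinearGroup.mapGL ℝ γ)

instance : SMulInvariantMeasure modularAut ℍ volume where
  measure_preimage_smul p t ht := by
    obtain ⟨γ, rfl⟩ := toAut_surjective p
    exact measure_preimage_smul_of_nullMeasurableSet ht.nullMeasurableSet γ

/-- `IsFundamentalDomain` wants a.e. disjoint translates for distinct group elements. Since -1 acts
trivially, this has to be stated for the group of transformations rather than for SL₂(ℤ). -/
lemma IsClosedFundamentalDomain.isFundamentalDomain {F : Set ℍ}
    (hF : IsClosedFundamentalDomain F) : IsFundamentalDomain modularAut F volume := by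
  refine .mk'' hF.isClosed.measurableSet.nullMeasurableSet (.of_forall fun τ => ?_)
    (fun p hp => ?_) (fun p => (measurePreserving_smul p volume).quasiMeasurePreserving)
  · obtain ⟨γ, hγ⟩ := hF.covers τ
    exact ⟨toAut γ, hγ⟩
  · obtain ⟨γ, rfl⟩ := toAut_surjective p
    have hγ := not_or.mp (toAut_eq_one_iff.not.mp hp)
    have h := hF.overlap γ⁻¹ (by simpa using hγ.1) (fun h => hγ.2 (by
      rw [← inv_inv γ, h]; simp))
    refine measure_mono_null ?_ h
    rintro _ ⟨⟨τ, hτ, rfl⟩, h2⟩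
    exact ⟨h2, by simpa using hτ⟩

lemma toAut_ker : toAut.ker = Subgroup.center SL(2, ℤ) := by
  ext γ
  rw [MonoidHom.mem_ker, toAut_eq_one_iff, Matrix.SpecialLinearGroup.mem_center_iff]
  constructor
  · rintro (rfl | rfl)
    · exact ⟨1, by simp, by simp⟩
    · exact ⟨-1, by simp, by simp⟩
  · rintro ⟨r, hr, h⟩
    have hr' : r = 1 ∨ r = -1 := by
      have : r ^ 2 = 1 := by simpa using hr
      exact mul_self_eq_one_iff.mp (by rwa [← sq])
    rcases hr' with rfl | rfl
    · left; ext i j; simp [← h]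
    · right; ext i j; simp [← h]

lemma omega_eq_card_stabilizer (z : ℍ) :
    omega z = Nat.card (MulAction.stabilizer modularAut z) := by
  have h : MulAction.stabilizer modularAut z = (MulAction.stabilizer SL(2, ℤ) z).map toAut := by
    ext p
    obtain ⟨γ, rfl⟩ := toAut_surjective p
    constructor
    · intro h
      exact ⟨γ, h, rfl⟩
    · rintro ⟨γ', h, h'⟩
      rw [← h']
      exact h
  -- Both cardinalities are the relative index in the stabilizer of one and the same kernel, the
  -- centre.
  rw [omega, h, ← Subgroup.relIndex_ker, ← Subgroup.relIndex_ker, QuotientGroup.ker_mk', toAut_ker]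

/-! ### The Eisenstein series as a sum over transformations -/

/-- The strip `0 ≤ Re τ < 1`, a fundamental domain for `Γ_∞`. -/
def strip : Set ℍ := {τ | 0 ≤ τ.re ∧ τ.re < 1}

lemma mem_GammaInf_iff {γ : SL(2, ℤ)} : γ ∈ GammaInf ↔ γ 1 0 = 0 := by
  rw [GammaInf, Subgroup.mem_comap, MulAction.mem_stabilizer_iff,
      OnePoint.smul_infty_eq_self_iff]
  simp

lemma T_zpow_mem_GammaInf (n : ℤ) : ModularGroup.T ^ n ∈ GammaInf := by
  rw [mem_GammaInf_iff, ModularGroup.coe_T_zpow]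
  simp

lemma exists_toAut_eq_T_zpow {γ : SL(2, ℤ)} (hγ : γ ∈ GammaInf) :
    ∃ n : ℤ, toAut γ = toAut (ModularGroup.T ^ n) := by
  obtain ⟨n, hn⟩ := ModularGroup.exists_eq_T_zpow_of_c_eq_zero (mem_GammaInf_iff.mp hγ)
  exact ⟨n, by ext τ : 2; exact hn τ⟩

lemma mem_GammaInf_of_toAut_eq {γ γ' : SL(2, ℤ)} (h : toAut γ = toAut γ') (hγ' : γ' ∈ GammaInf) :
    γ ∈ GammaInf := by
  rw [mem_GammaInf_iff] at *
  rcases toAut_eq_iff.mp h with rfl | rfl <;> simp [hγ']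

/-- The representative of a coset of `Γ_∞` that maps `τ` into the strip. -/
def stripRep (τ : ℍ) (c : Quotient (QuotientGroup.rightRel GammaInf)) : modularAut :=
  toAut (ModularGroup.T ^ (-⌊(c.out • τ).re⌋) * c.out)

lemma stripRep_smul (τ : ℍ) (c : Quotient (QuotientGroup.rightRel GammaInf)) :
    stripRep τ c • τ = ModularGroup.T ^ (-⌊(c.out • τ).re⌋) • c.out • τ := by
  rw [stripRep, toAut_smul, mul_smul]

lemma stripRep_smul_mem (τ : ℍ) (c : Quotient (QuotientGroup.rightRel GammaInf)) :
    stripRep τ c • τ ∈ strip := by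
  rw [stripRep_smul, strip, Set.mem_ofPred_eq, ModularGroup.re_T_zpow_smul]
  push_cast
  constructor
  · linarith [Int.floor_le (c.out • τ).re]
  · linarith [Int.lt_floor_add_one (c.out • τ).re]

lemma im_stripRep_smul (τ : ℍ) (c : Quotient (QuotientGroup.rightRel GammaInf)) :
    (stripRep τ c • τ).im = cosetIm τ c := by
  rw [stripRep_smul, ModularGroup.im_T_zpow_smul]
  conv_rhs => rw [← Quotient.out_eq c]
  rfl

lemma stripRep_injective (τ : ℍ) : Function.Injective (stripRep τ) := by
  intro c c' h
  rw [← Quotient.out_eq c, ← Quotient.out_eq c', Quotient.eq]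
  refine QuotientGroup.rightRel_apply.mpr ?_
  have h' : toAut (c'.out * c.out⁻¹) = toAut (ModularGroup.T ^ (⌊(c'.out • τ).re⌋) *
      ModularGroup.T ^ (-⌊(c.out • τ).re⌋)) := by
    rw [stripRep, stripRep, map_mul, map_mul, ← mul_inv_eq_iff_eq_mul] at h
    rw [map_mul, map_mul, map_inv, mul_inv_eq_iff_eq_mul]
    rw [mul_inv_eq_iff_eq_mul] at h
    rw [mul_assoc, h, zpow_neg, map_inv, mul_inv_cancel_left]
  exact mem_GammaInf_of_toAut_eq h'
    (mul_mem (T_zpow_mem_GammaInf _) (T_zpow_mem_GammaInf _))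

lemma mem_range_stripRep {τ : ℍ} {p : modularAut} (hp : p • τ ∈ strip) :
    p ∈ Set.range (stripRep τ) := by
  obtain ⟨γ, rfl⟩ := toAut_surjective p
  let c := Quotient.mk (QuotientGroup.rightRel GammaInf) γ
  have hc : c.out * γ⁻¹ ∈ GammaInf := QuotientGroup.rightRel_apply.mp
    ((QuotientGroup.rightRel GammaInf).symm (Quotient.mk_out (s := QuotientGroup.rightRel GammaInf) γ))
  obtain ⟨k, hk⟩ := exists_toAut_eq_T_zpow hc
  have hout : toAut c.out = toAut (ModularGroup.T ^ k * γ) := by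
    rw [map_mul, map_inv, mul_inv_eq_iff_eq_mul] at hk
    rw [hk, map_mul]
  have hre : (c.out • τ).re = (γ • τ).re + k := by
    rw [← toAut_smul, hout, toAut_smul, mul_smul, ModularGroup.re_T_zpow_smul]
  have hfl : ⌊(c.out • τ).re⌋ = k := by
    have h0 : ⌊(γ • τ).re⌋ = 0 := Int.floor_eq_zero_iff.mpr ⟨hp.1, hp.2⟩
    rw [hre, Int.floor_add_intCast, h0, zero_add]
  refine ⟨c, ?_⟩
  rw [stripRep, hfl, map_mul, hout, ← map_mul, ← mul_assoc, zpow_neg, inv_mul_cancel, one_mul]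

/-- Up to sign, each coset of Γ_∞ has exactly one element carrying τ into the strip. Summing an
indicator over the whole group is the form needed both for unfolding and for sorting by orbits. -/
lemma hasSum_coset_iff {E : Type*} [AddCommMonoid E] [TopologicalSpace E] (w : ℝ → E) (τ : ℍ)
    (a : E) : HasSum (fun c => w (cosetIm τ c)) a ↔
      HasSum (fun p : modularAut => strip.indicator (fun z => w z.im) (p • τ)) a := by
  rw [← (stripRep_injective τ).hasSum_iff]
  · refine iff_of_eq (congrArg (HasSum · a) ?_)
    funext c
    rw [Function.comp_apply, Set.indicator_of_mem (stripRep_smul_mem τ c), im_stripRep_smul]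
  · intro p hp
    exact Set.indicator_of_notMem (fun h => hp (mem_range_stripRep h)) _

/-! ### The Eisenstein series as a sum over pairs of integers -/

/-- The quadratic form `|mτ + n|² / Im τ`. -/
def pairForm (τ : ℍ) (v : Fin 2 → ℤ) : ℝ := ‖(v 0 : ℂ) * τ + v 1‖ ^ 2 / τ.im

lemma pairForm_nonneg (τ : ℍ) (v : Fin 2 → ℤ) : 0 ≤ pairForm τ v :=
  div_nonneg (sq_nonneg _) τ.im_pos.le

@[simp] lemma pairForm_zero (τ : ℍ) : pairForm τ 0 = 0 := by simp [pairForm]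

lemma pairForm_pos (τ : ℍ) {v : Fin 2 → ℤ} (hv : v ≠ 0) : 0 < pairForm τ v := by
  have h := EisensteinSeries.r_mul_max_le τ hv
  have h2 : 0 < ‖(v 0 : ℂ) * τ + v 1‖ :=
    (mul_pos (EisensteinSeries.r_pos τ) (norm_pos_iff.mpr hv)).trans_le h
  exact div_pos (pow_pos h2 2) τ.im_pos

lemma pairForm_smul (τ : ℍ) (r : ℤ) (v : Fin 2 → ℤ) :
    pairForm τ (r • v) = (r : ℝ) ^ 2 * pairForm τ v := by
  have h : ((r • v) 0 : ℂ) * τ + (r • v) 1 = r * ((v 0 : ℂ) * τ + v 1) := by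
    simp; ring
  have h2 : ‖(r : ℂ)‖ ^ 2 = (r : ℝ) ^ 2 := by simp
  rw [pairForm, h, norm_mul, mul_pow, h2, pairForm, mul_div_assoc]

lemma im_smul_eq_inv_pairForm (γ : SL(2, ℤ)) (τ : ℍ) : (γ • τ).im = (pairForm τ (γ 1))⁻¹ := by
  rw [ModularGroup.im_smul_eq_div_normSq, pairForm, inv_div, Complex.normSq_eq_norm_sq,
    ModularGroup.denom_apply]

lemma ofReal_inv_cpow {x : ℝ} (hx : 0 ≤ x) (s : ℂ) : ((x⁻¹ : ℝ) : ℂ) ^ s = 1 / (x : ℂ) ^ s := by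
  rw [Complex.ofReal_inv, Complex.inv_cpow, one_div]
  rw [Complex.arg_ofReal_of_nonneg hx]
  exact Real.pi_pos.ne

lemma rpow_neg_pairForm_le (τ : ℍ) {a : ℝ} (ha : 0 ≤ a) (v : Fin 2 → ℤ) :
    pairForm τ v ^ (-a) ≤
      τ.im ^ a * EisensteinSeries.r τ ^ (-(2 * a)) * ‖v‖ ^ (-(2 * a)) := by
  have h := EisensteinSeries.summand_bound τ (k := 2 * a) (by linarith) v
  rw [pairForm, Real.div_rpow (sq_nonneg _) τ.im_pos.le, ← Real.rpow_natCast,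
    ← Real.rpow_mul (norm_nonneg _), Real.rpow_neg τ.im_pos.le, div_inv_eq_mul, mul_assoc,
    mul_comm]
  push_cast
  rw [mul_neg]
  exact mul_le_mul_of_nonneg_left h (Real.rpow_nonneg τ.im_pos.le _)

lemma summable_pairForm_rpow (τ : ℍ) {a : ℝ} (ha : 1 < a) :
    Summable fun v => pairForm τ v ^ (-a) := by
  refine Summable.of_nonneg_of_le (fun v => Real.rpow_nonneg (pairForm_nonneg τ v) _)
    (rpow_neg_pairForm_le τ (by linarith)) (Summable.mul_left _ ?_)
  exact EisensteinSeries.summable_one_div_norm_rpow (k := 2 * a) (by linarith)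

lemma norm_pairForm_cpow (τ : ℍ) {s : ℂ} (hs : 0 < s.re) (v : Fin 2 → ℤ) :
    ‖1 / (pairForm τ v : ℂ) ^ s‖ = pairForm τ v ^ (-s.re) := by
  rw [norm_div, norm_one, Complex.norm_cpow_eq_rpow_re_of_nonneg (pairForm_nonneg τ v) hs.ne',
    Real.rpow_neg (pairForm_nonneg τ v), one_div]

lemma summable_pairForm_cpow (τ : ℍ) {s : ℂ} (hs : 1 < s.re) :
    Summable fun v => 1 / (pairForm τ v : ℂ) ^ s := by
  refine .of_norm ?_
  simp_rw [norm_pairForm_cpow τ (zero_lt_one.trans hs)]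
  exact summable_pairForm_rpow τ hs

/-- Up to sign, the bottom row of a matrix in `SL₂(ℤ)` determines the coset modulo `Γ_∞`. -/
def signedRow (x : Quotient (QuotientGroup.rightRel GammaInf) × ℤˣ) :
    EisensteinSeries.gammaSet 1 1 0 :=
  ⟨fun i => (x.2 : ℤ) * x.1.out 1 i, by
    rw [EisensteinSeries.mem_gammaSet_one, Int.isCoprime_iff_gcd_eq_one, Int.gcd_mul_left,
      Int.units_natAbs, one_mul, ← Int.isCoprime_iff_gcd_eq_one]
    exact ModularGroup.bottom_row_coprime x.1.out⟩

lemma mul_inv_mem_GammaInf_iff (γ γ' : SL(2, ℤ)) :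
    γ * γ'⁻¹ ∈ GammaInf ↔ γ 1 0 * γ' 1 1 = γ 1 1 * γ' 1 0 := by
  rw [mem_GammaInf_iff, Matrix.SpecialLinearGroup.coe_mul, Matrix.SpecialLinearGroup.coe_inv,
    Matrix.adjugate_fin_two, Matrix.mul_apply, Fin.sum_univ_two]
  simp only [Matrix.of_apply, Matrix.cons_val_zero, Matrix.cons_val_one, Matrix.cons_val']
  simp only [mul_neg]
  rw [← sub_eq_add_neg, sub_eq_zero]

lemma signedRow_injective : Function.Injective signedRow := by
  rintro ⟨c, ε⟩ ⟨c', ε'⟩ h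
  have h' : ∀ i, (ε : ℤ) * c.out 1 i = ε' * c'.out 1 i := fun i =>
    congrFun (congrArg Subtype.val h) i
  have hε : (ε : ℤ) * ε = 1 := by rw [← Units.val_mul, Int.units_mul_self, Units.val_one]
  have hrow : ∀ i, c.out 1 i = ε * ε' * c'.out 1 i := fun i => by
    rw [mul_assoc, ← h', ← mul_assoc, hε, one_mul]
  have hc : c = c' := by
    rw [← Quotient.out_eq c, ← Quotient.out_eq c', Quotient.eq]
    refine QuotientGroup.rightRel_apply.mpr ?_
    rw [mul_inv_mem_GammaInf_iff, hrow, hrow]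
    ring
  subst hc
  have hne : ∃ i, c.out 1 i ≠ 0 := by
    by_contra! h0
    have := ModularGroup.bottom_row_coprime c.out
    rw [h0, h0] at this
    exact not_isCoprime_zero_zero this
  obtain ⟨i, hi⟩ := hne
  rw [Units.ext (mul_right_cancel₀ hi (h' i))]

lemma signedRow_surjective : Function.Surjective signedRow := by
  rintro ⟨v, hv⟩
  have hv' := (EisensteinSeries.mem_gammaSet_one v).mp hv
  obtain ⟨γ, -, hγ⟩ := ModularGroup.bottom_row_surj hv'
  let c := Quotient.mk (QuotientGroup.rightRel GammaInf) γ
  have hc : c.out * γ⁻¹ ∈ GammaInf := QuotientGroup.rightRel_apply.mp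
    ((QuotientGroup.rightRel GammaInf).symm (Quotient.mk_out (s := QuotientGroup.rightRel GammaInf) γ))
  rw [mul_inv_mem_GammaInf_iff] at hc
  have h1 := ModularGroup.bottom_row_coprime c.out
  have hγ' : ∀ i, γ 1 i = v i := fun i => congrFun hγ i
  rw [hγ', hγ'] at hc
  obtain ⟨x, y, hxy⟩ := hv'
  obtain ⟨x', y', hxy'⟩ := h1
  -- The two coprime rows are proportional. The Bézout relation of v gives the ratio as an integer,
  -- and that of the other row makes this integer a unit.
  have e0 : c.out 1 0 = (x * c.out 1 0 + y * c.out 1 1) * v 0 := by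
    linear_combination c.out 1 0 * -hxy + y * hc
  have e1 : c.out 1 1 = (x * c.out 1 0 + y * c.out 1 1) * v 1 := by
    linear_combination c.out 1 1 * -hxy - x * hc
  have hu : (x * c.out 1 0 + y * c.out 1 1) * (x' * v 0 + y' * v 1) = 1 := by
    linear_combination hxy' - x' * e0 - y' * e1
  let ε : ℤˣ := ⟨_, _, hu, by rw [mul_comm]; exact hu⟩
  have hε : (ε : ℤ) * ε = 1 := by rw [← Units.val_mul, Int.units_mul_self, Units.val_one]
  refine ⟨(c, ε), Subtype.ext (funext fun i => ?_)⟩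
  change (ε : ℤ) * c.out 1 i = v i
  fin_cases i
  · change (ε : ℤ) * c.out 1 0 = v 0
    rw [e0]
    change (ε : ℤ) * (ε * v 0) = v 0
    rw [← mul_assoc, hε, one_mul]
  · change (ε : ℤ) * c.out 1 1 = v 1
    rw [e1]
    change (ε : ℤ) * (ε * v 1) = v 1
    rw [← mul_assoc, hε, one_mul]

lemma pairForm_signedRow (τ : ℍ) (x : Quotient (QuotientGroup.rightRel GammaInf) × ℤˣ) :
    (pairForm τ (signedRow x))⁻¹ = cosetIm τ x.1 := by
  have h : ((signedRow x : Fin 2 → ℤ)) = (x.2 : ℤ) • (x.1.out 1) := rfl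
  have hε : ((x.2 : ℤ) : ℝ) ^ 2 = 1 := by
    rw [← Int.cast_pow, ← Units.val_pow_eq_pow_val, Int.units_sq, Units.val_one, Int.cast_one]
  rw [h, pairForm_smul, hε, one_mul, ← im_smul_eq_inv_pairForm]
  conv_rhs => rw [← Quotient.out_eq x.1]
  rfl

/-- The factor 2 counts the signs in `signedRow`; convergence of the Eisenstein series comes from
that of the sum over all pairs. -/
lemma tsum_coprime_pairForm (τ : ℍ) {s : ℂ} (hs : 1 < s.re) :
    Summable (fun c => ((cosetIm τ c : ℝ) : ℂ) ^ s) ∧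
    ∑' v : EisensteinSeries.gammaSet 1 1 0, 1 / (pairForm τ v : ℂ) ^ s =
      2 * eisensteinSeries τ s := by
  have hsum : Summable fun v : EisensteinSeries.gammaSet 1 1 0 => 1 / (pairForm τ v : ℂ) ^ s :=
    (summable_pairForm_cpow τ hs).subtype _
  let e := Equiv.ofBijective signedRow ⟨signedRow_injective, signedRow_surjective⟩
  have he : ∀ x, 1 / (pairForm τ (e x) : ℂ) ^ s = ((cosetIm τ x.1 : ℝ) : ℂ) ^ s := fun x => by
    rw [← pairForm_signedRow, ofReal_inv_cpow (pairForm_nonneg _ _)]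
    rfl
  have hsum' : Summable fun x : Quotient (QuotientGroup.rightRel GammaInf) × ℤˣ =>
      ((cosetIm τ x.1 : ℝ) : ℂ) ^ s := by
    simpa only [Function.comp_def, he] using e.summable_iff.mpr hsum
  refine ⟨hsum'.comp_injective (i := fun c => (c, (1 : ℤˣ))) fun a b h => (Prod.ext_iff.mp h).1, ?_⟩
  rw [← e.tsum_eq]
  simp_rw [he]
  rw [hsum'.tsum_prod, eisensteinSeries, ← tsum_mul_left]
  refine tsum_congr fun c => ?_
  rw [tsum_fintype]
  simp

/-- Sort the pairs by their gcd r: dividing by r leaves a coprime pair and a factor r^(-2s), and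
these factors add up to the zeta value. -/
lemma tsum_pairForm (τ : ℍ) {s : ℂ} (hs : 1 < s.re) :
    ∑' v, 1 / (pairForm τ v : ℂ) ^ s = 2 * riemannZeta (2 * s) * eisensteinSeries τ s := by
  have hs0 : s ≠ 0 := fun h => by norm_num [h] at hs
  have h2s : 1 < (2 * s).re := by simp; linarith
  have key : ∀ r : ℕ, ∑' v : EisensteinSeries.gammaSet 1 r 0, 1 / (pairForm τ v : ℂ) ^ s =
      1 / (r : ℂ) ^ (2 * s) * (2 * eisensteinSeries τ s) := by
    intro r
    -- The class r = 0 consists of the zero vector; both sides vanish because 0^s = 0 and 1 / 0 = 0.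
    rcases eq_or_ne r 0 with rfl | hr
    · have : ∀ v : EisensteinSeries.gammaSet 1 0 0, 1 / (pairForm τ v : ℂ) ^ s = 0 := fun v => by
        have hv := (EisensteinSeries.gammaSet_one_mem_iff 0 v.1).mp v.2
        rw [Int.gcd_eq_zero_iff] at hv
        have : v.1 = 0 := by ext i; fin_cases i; exacts [hv.1, hv.2]
        simp [this, hs0]
      simp [this, hs0]
    · have : NeZero r := ⟨hr⟩
      rw [← (tsum_coprime_pairForm τ hs).2, ← tsum_mul_left,
        ← (EisensteinSeries.gammaSetDivGcdEquiv r).tsum_eq]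
      refine tsum_congr fun v => ?_
      have h1 : v.1 = (r : ℤ) • EisensteinSeries.divIntMap r v.1 := by
        simpa using EisensteinSeries.gammaSet_eq_gcd_mul_divIntMap v.2
      rw [h1, pairForm_smul, EisensteinSeries.gammaSetDivGcdEquiv_eq]
      rw [Complex.ofReal_mul, Complex.mul_cpow_ofReal_nonneg (by positivity) (pairForm_nonneg _ _),
        ← one_div_mul_one_div]
      congr 2
      · push_cast
        rw [← Complex.cpow_ofNat_mul'] <;> simp [Real.pi_pos, Real.pi_pos.le]
  rw [← EisensteinSeries.gammaSetDivGcdSigmaEquiv.symm.tsum_eq]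
  simp_rw [EisensteinSeries.gammaSetDivGcdSigmaEquiv_symm_eq]
  rw [Summable.tsum_sigma]
  · simp_rw [key]
    rw [tsum_mul_right, ← zeta_eq_tsum_one_div_nat_cpow h2s]
    ring
  · exact (EisensteinSeries.gammaSetDivGcdSigmaEquiv.symm.summable_iff
      (f := fun v => 1 / (pairForm τ v : ℂ) ^ s)).mpr (summable_pairForm_cpow τ hs)

/-! ### The theta function of the quadratic form -/

/-- The pair sum `∑ (Im τ / |mτ + n|²) ^ k`, which bounds everything else. -/
def pairSum (τ : ℍ) (k : ℕ) : ℝ := ∑' v, pairForm τ v ^ (-(k : ℝ))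

lemma pairSum_nonneg (τ : ℍ) (k : ℕ) : 0 ≤ pairSum τ k :=
  tsum_nonneg fun _ => Real.rpow_nonneg (pairForm_nonneg _ _) _

lemma exp_neg_le_factorial_mul_rpow (k : ℕ) {x : ℝ} (hx : 0 < x) :
    Real.exp (-x) ≤ k.factorial * x ^ (-(k : ℝ)) := by
  have h := Real.pow_div_factorial_le_exp x hx.le k
  rw [Real.exp_neg, Real.rpow_neg hx.le, Real.rpow_natCast, ← div_eq_mul_inv]
  rw [inv_le_comm₀ (Real.exp_pos _) (by positivity), inv_div]
  exact h

lemma exp_neg_pairForm_le (τ : ℍ) (k : ℕ) {t : ℝ} (ht : 0 < t) {v : Fin 2 → ℤ} (hv : v ≠ 0) :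
    Real.exp (-Real.pi * pairForm τ v * t) ≤
      k.factorial * t ^ (-(k : ℝ)) * pairForm τ v ^ (-(k : ℝ)) := by
  have hq := pairForm_pos τ hv
  have h1 : Real.exp (-Real.pi * pairForm τ v * t) ≤ Real.exp (-(t * pairForm τ v)) := by
    rw [Real.exp_le_exp]
    have : 0 < t * pairForm τ v := mul_pos ht hq
    nlinarith [Real.pi_gt_three]
  refine h1.trans ((exp_neg_le_factorial_mul_rpow k (mul_pos ht hq)).trans_eq ?_)
  rw [Real.mul_rpow ht.le hq.le, mul_assoc]

/-- The terms of the theta function, without the constant one. -/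
def thetaTerm (τ : ℍ) (t : ℝ) (v : Fin 2 → ℤ) : ℝ :=
  if v = 0 then 0 else Real.exp (-Real.pi * pairForm τ v * t)

lemma thetaTerm_nonneg (τ : ℍ) (t : ℝ) (v : Fin 2 → ℤ) : 0 ≤ thetaTerm τ t v := by
  unfold thetaTerm
  split_ifs
  exacts [le_rfl, (Real.exp_pos _).le]

lemma thetaTerm_le (τ : ℍ) {k : ℕ} (hk : k ≠ 0) {t : ℝ} (ht : 0 < t) (v : Fin 2 → ℤ) :
    thetaTerm τ t v ≤ k.factorial * t ^ (-(k : ℝ)) * pairForm τ v ^ (-(k : ℝ)) := by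
  unfold thetaTerm
  split_ifs with h
  · simp [h, hk]
  · exact exp_neg_pairForm_le τ k ht h

lemma summable_pairForm_nat (τ : ℍ) {k : ℕ} (hk : 2 ≤ k) :
    Summable fun v => pairForm τ v ^ (-(k : ℝ)) :=
  summable_pairForm_rpow τ (by exact_mod_cast hk)

lemma summable_thetaTerm (τ : ℍ) {t : ℝ} (ht : 0 < t) : Summable (thetaTerm τ t) :=
  Summable.of_nonneg_of_le (thetaTerm_nonneg τ t) (thetaTerm_le τ two_ne_zero ht)
    ((summable_pairForm_nat τ le_rfl).mul_left _)

/-- The theta function `∑ exp (-π t |mτ + n|² / Im τ)` without its constant term. -/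
def thetaZero (τ : ℍ) (t : ℝ) : ℝ := ∑' v, thetaTerm τ t v

lemma thetaZero_nonneg (τ : ℍ) (t : ℝ) : 0 ≤ thetaZero τ t := tsum_nonneg (thetaTerm_nonneg τ t)

/-- Decay in t of any order k ≥ 2, with the whole dependence on τ in the invariant factor `pairSum τ
k`. This is what later dominates integrals over τ. -/
lemma thetaZero_le (τ : ℍ) {k : ℕ} (hk : 2 ≤ k) {t : ℝ} (ht : 0 < t) :
    thetaZero τ t ≤ k.factorial * t ^ (-(k : ℝ)) * pairSum τ k := by
  rw [thetaZero, pairSum, ← tsum_mul_left]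
  exact Summable.tsum_le_tsum (thetaTerm_le τ (by omega) ht) (summable_thetaTerm τ ht)
    ((summable_pairForm_nat τ hk).mul_left _)

lemma antitoneOn_thetaZero (τ : ℍ) : AntitoneOn (thetaZero τ) (Set.Ioi 0) := by
  intro a ha b hb hab
  refine Summable.tsum_le_tsum (fun v => ?_) (summable_thetaTerm τ hb) (summable_thetaTerm τ ha)
  unfold thetaTerm
  split_ifs
  · exact le_rfl
  · rw [Real.exp_le_exp]
    have := mul_nonneg Real.pi_pos.le (pairForm_nonneg τ v)
    nlinarith

lemma hasSum_theta (τ : ℍ) {t : ℝ} (ht : 0 < t) :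
    HasSum (fun v => Real.exp (-Real.pi * pairForm τ v * t)) (1 + thetaZero τ t) := by
  have h : HasSum (fun v => (if v = 0 then (1 : ℝ) else 0) + thetaTerm τ t v) (1 + thetaZero τ t) :=
    (hasSum_ite_eq (0 : Fin 2 → ℤ) (1 : ℝ)).add (summable_thetaTerm τ ht).hasSum
  refine h.congr_fun fun v => ?_
  unfold thetaTerm
  split_ifs with hv <;> simp [hv]

lemma summable_exp_neg_int_sq {c : ℝ} (hc : 0 < c) :
    Summable fun n : ℤ => Real.exp (-Real.pi * c * (n : ℝ) ^ 2) := by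
  have h := ((summable_jacobiTheta₂_term_iff 0 (Complex.I * c)).mpr (by simpa using hc)).norm
  refine h.congr fun n => ?_
  rw [jacobiTheta₂_term, Complex.norm_exp]
  congr 1
  have : 2 * (Real.pi : ℂ) * Complex.I * n * 0 + Real.pi * Complex.I * n ^ 2 * (Complex.I * c) =
      ((-Real.pi * c * (n : ℝ) ^ 2 : ℝ) : ℂ) := by
    push_cast
    linear_combination (Real.pi * n ^ 2 * c : ℂ) * Complex.I_sq
  rw [this, Complex.ofReal_re]

/-- The terms of the theta function after Poisson summation in one variable. -/
def poissonTerm (τ : ℍ) (t : ℝ) (p : ℤ × ℤ) : ℂ :=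
  Complex.exp (-Real.pi * (t * τ.im) * (p.1 : ℂ) ^ 2) *
    Complex.exp (-Real.pi * (τ.im / t) * (p.2 : ℂ) ^ 2 +
      2 * Real.pi * (-Complex.I * p.1 * τ.re) * p.2)

lemma summable_poissonTerm (τ : ℍ) {t : ℝ} (ht : 0 < t) : Summable (poissonTerm τ t) := by
  refine .of_norm ?_
  have h := (summable_exp_neg_int_sq (mul_pos ht τ.im_pos)).mul_of_nonneg
    (summable_exp_neg_int_sq (div_pos τ.im_pos ht)) (fun _ => (Real.exp_pos _).le)
    (fun _ => (Real.exp_pos _).le)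
  refine h.congr fun p => ?_
  rw [poissonTerm, norm_mul, Complex.norm_exp, Complex.norm_exp]
  have h1 : -(Real.pi : ℂ) * (t * τ.im) * (p.1 : ℂ) ^ 2 =
      ((-Real.pi * (t * τ.im) * (p.1 : ℝ) ^ 2 : ℝ) : ℂ) := by push_cast; ring
  have h2 : -(Real.pi : ℂ) * (τ.im / t) * (p.2 : ℂ) ^ 2 +
      2 * Real.pi * (-Complex.I * p.1 * τ.re) * p.2 =
      ((-Real.pi * (τ.im / t) * (p.2 : ℝ) ^ 2 : ℝ) : ℂ) +
        ((-(2 * Real.pi * p.1 * τ.re * p.2) : ℝ) : ℂ) * Complex.I := by push_cast; ring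
  rw [h1, h2, Complex.ofReal_re, Complex.add_re, Complex.ofReal_re, Complex.re_ofReal_mul,
    Complex.I_re, mul_zero, add_zero]

/-- After Poisson summation in n alone, the exponent is symmetric under exchanging m and n together
with t and 1/t. The functional equation of theta is this symmetry. -/
lemma poissonTerm_swap (τ : ℍ) {t : ℝ} (p : ℤ × ℤ) :
    poissonTerm τ (1 / t) p.swap = poissonTerm τ t p := by
  rw [poissonTerm, poissonTerm, ← Complex.exp_add, ← Complex.exp_add]
  congr 1
  simp only [Prod.fst_swap, Prod.snd_swap]
  push_cast
  rw [div_div_eq_mul_div, div_one]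
  ring

lemma theta_eq_tsum_poissonTerm (τ : ℍ) {t : ℝ} (ht : 0 < t) :
    ((1 + thetaZero τ t : ℝ) : ℂ) =
      ((τ.im / t : ℝ) : ℂ) ^ (1 / 2 : ℂ) * ∑' p, poissonTerm τ t p := by
  have ha : (0 : ℝ) < (((τ.im / t : ℝ) : ℂ)).re := by
    rw [Complex.ofReal_re]; exact div_pos τ.im_pos ht
  have ha0 : ((τ.im / t : ℝ) : ℂ) ≠ 0 := fun h => by simp [h] at ha
  have hs : Summable fun v => Complex.exp ((-Real.pi * pairForm τ v * t : ℝ)) := by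
    have := Complex.ofRealCLM.summable (hasSum_theta τ ht).summable
    simpa using this
  rw [← (hasSum_theta τ ht).tsum_eq, Complex.ofReal_tsum]
  simp_rw [Complex.ofReal_exp]
  rw [← (finTwoArrowEquiv ℤ).symm.tsum_eq, Summable.tsum_prod, (summable_poissonTerm τ ht).tsum_prod,
    ← tsum_mul_left]
  · refine tsum_congr fun m => ?_
    -- Poisson is applied from the dual side: for a = Im τ / t and this shift, n + ib = n + m Re τ,
    -- so the transformed exponent is that of `pairForm`.
    have h := Complex.tsum_exp_neg_quadratic ha (-Complex.I * m * τ.re)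
    have h' : ∑' n : ℤ, poissonTerm τ t (m, n) = Complex.exp (-Real.pi * (t * τ.im) * (m : ℂ) ^ 2) *
        ∑' n : ℤ, Complex.exp (-Real.pi * ((τ.im / t : ℝ) : ℂ) * n ^ 2 +
          2 * Real.pi * (-Complex.I * m * τ.re) * n) := by
      rw [← tsum_mul_left]
      simp [poissonTerm]
    rw [h', h, mul_left_comm, ← mul_assoc, ← mul_assoc, mul_assoc (Complex.exp _),
      mul_one_div_cancel (by simp [τ.im_pos.ne', ht.ne']), mul_one, ← tsum_mul_left]
    refine tsum_congr fun n => ?_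
    rw [← Complex.exp_add]
    congr 1
    have hv : (τ.im : ℂ) ≠ 0 := by exact_mod_cast τ.im_pos.ne'
    have ht' : (t : ℂ) ≠ 0 := by exact_mod_cast ht.ne'
    have hq : pairForm τ ((finTwoArrowEquiv ℤ).symm (m, n)) =
        ((m * τ.re + n) ^ 2 + (m * τ.im) ^ 2) / τ.im := by
      rw [pairForm, ← Complex.normSq_eq_norm_sq, Complex.normSq_apply]
      simp [sq]
    rw [hq]
    push_cast
    have hI : (n + Complex.I * (-Complex.I * m * τ.re)) = (n + m * τ.re : ℂ) := by
      linear_combination (-(m * τ.re : ℂ)) * Complex.I_sq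
    rw [hI]
    field_simp
    ring
  · exact (finTwoArrowEquiv ℤ).symm.summable_iff.mpr hs

lemma theta_functional_equation (τ : ℍ) {t : ℝ} (ht : 0 < t) :
    1 + thetaZero τ (1 / t) = t * (1 + thetaZero τ t) := by
  rw [← Complex.ofReal_inj, theta_eq_tsum_poissonTerm τ (one_div_pos.mpr ht), Complex.ofReal_mul,
    theta_eq_tsum_poissonTerm τ ht, ← (Equiv.prodComm ℤ ℤ).tsum_eq]
  have h : ∀ p : ℤ × ℤ, poissonTerm τ (1 / t) (Equiv.prodComm ℤ ℤ p) = poissonTerm τ t p :=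
    poissonTerm_swap τ
  simp_rw [h]
  rw [← mul_assoc]
  congr 1
  have e : ((1 / 2 : ℂ)) = ((1 / 2 : ℝ) : ℂ) := by push_cast; rfl
  rw [e, ← Complex.ofReal_cpow (div_pos τ.im_pos (one_div_pos.mpr ht)).le,
    ← Complex.ofReal_cpow (div_pos τ.im_pos ht).le, ← Complex.ofReal_mul, Complex.ofReal_inj,
    ← Real.sqrt_eq_rpow, ← Real.sqrt_eq_rpow]
  -- Only the prefactors differ: √(t Im τ) = t √(Im τ / t).
  have h2 : τ.im / (1 / t) = t ^ 2 * (τ.im / t) := by field_simp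
  rw [h2, Real.sqrt_mul (sq_nonneg t), Real.sqrt_sq ht.le]

/-! ### The completed Eisenstein series -/

lemma locallyIntegrableOn_theta (τ : ℍ) :
    LocallyIntegrableOn (fun t => ((1 + thetaZero τ t : ℝ) : ℂ)) (Set.Ioi 0) := by
  rw [locallyIntegrableOn_iff isOpen_Ioi.isLocallyClosed]
  intro k hk hkc
  exact (AntitoneOn.integrableOn_isCompact hkc
    (fun a ha b hb hab => by
      have := antitoneOn_thetaZero τ (hk ha) (hk hb) hab
      simpa using this : AntitoneOn (fun t => 1 + thetaZero τ t) k)).ofReal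

lemma thetaZero_isBigO (τ : ℍ) (r : ℝ) :
    (fun t => ((1 + thetaZero τ t : ℝ) : ℂ) - 1) =O[atTop] (fun t => t ^ r) := by
  -- The bound 2 ensures convergence of the pair sum, and -r the required rate.
  obtain ⟨k, hk⟩ := exists_nat_ge (max 2 (-r))
  have hk2 : 2 ≤ k := by exact_mod_cast (le_max_left _ _).trans hk
  have hkr : -(k : ℝ) ≤ r := by linarith [(le_max_right 2 (-r)).trans hk]
  refine Asymptotics.IsBigO.of_bound (k.factorial * pairSum τ k) ?_
  filter_upwards [eventually_ge_atTop 1] with t ht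
  have ht0 : 0 < t := zero_lt_one.trans_le ht
  have h := thetaZero_le τ hk2 ht0
  have e : ((1 + thetaZero τ t : ℝ) : ℂ) - 1 = (thetaZero τ t : ℂ) := by push_cast; ring
  rw [e, Complex.norm_real, Real.norm_of_nonneg (thetaZero_nonneg _ _),
    Real.norm_of_nonneg (Real.rpow_nonneg ht0.le _)]
  refine h.trans ?_
  rw [mul_right_comm]
  exact mul_le_mul_of_nonneg_left (Real.rpow_le_rpow_of_exponent_le ht hkr)
    (mul_nonneg (Nat.cast_nonneg _) (pairSum_nonneg _ _))

/-- The theta function with its functional equation. -/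
def thetaPair (τ : ℍ) : WeakFEPair ℂ where
  f t := ((1 + thetaZero τ t : ℝ) : ℂ)
  g t := ((1 + thetaZero τ t : ℝ) : ℂ)
  k := 1
  ε := 1
  f₀ := 1
  g₀ := 1
  hf_int := locallyIntegrableOn_theta τ
  hg_int := locallyIntegrableOn_theta τ
  hk := one_pos
  hε := one_ne_zero
  h_feq t ht := by
    rw [theta_functional_equation τ ht, Real.rpow_one, one_mul, smul_eq_mul, Complex.ofReal_mul]
  hf_top := thetaZero_isBigO τ
  hg_top := thetaZero_isBigO τ

lemma thetaPair_f_modif_of_one_lt (τ : ℍ) {t : ℝ} (ht : 1 < t) :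
    (thetaPair τ).f_modif t = (thetaZero τ t : ℂ) := by
  rw [WeakFEPair.f_modif, Pi.add_apply, Set.indicator_of_mem (Set.mem_Ioi.mpr ht),
    Set.indicator_of_notMem (fun h => absurd h.2 (not_lt.mpr ht.le)), add_zero]
  simp [thetaPair]

lemma thetaPair_f_modif_of_lt_one (τ : ℍ) {t : ℝ} (h0 : 0 < t) (ht : t < 1) :
    (thetaPair τ).f_modif t = ((t⁻¹ * thetaZero τ (1 / t) : ℝ) : ℂ) := by
  rw [WeakFEPair.f_modif, Pi.add_apply,
    Set.indicator_of_notMem (Set.notMem_Ioi.mpr ht.le),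
    Set.indicator_of_mem (Set.mem_Ioo.mpr ⟨h0, ht⟩), zero_add]
  have h := theta_functional_equation τ (one_div_pos.mpr h0)
  rw [one_div_one_div] at h
  simp only [thetaPair, h, Real.rpow_neg_one, one_mul, smul_eq_mul]
  push_cast
  ring

lemma thetaPair_f_modif_one (τ : ℍ) : (thetaPair τ).f_modif 1 = 0 := by
  simp [WeakFEPair.f_modif]

/-- The constant in the estimate of the completed Eisenstein series. -/
def thetaConst (k : ℕ) : ℝ :=
  k.factorial * ∫ t in Set.Ioi (0 : ℝ), if t ≤ 1 then (1 : ℝ) else t ^ (-2 : ℝ)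

lemma integrableOn_thetaBound :
    IntegrableOn (fun t : ℝ => if t ≤ 1 then (1 : ℝ) else t ^ (-2 : ℝ)) (Set.Ioi 0) := by
  rw [← Set.Ioc_union_Ioi_eq_Ioi zero_le_one]
  refine IntegrableOn.union ?_ ?_
  · refine (integrableOn_const (C := (1 : ℝ)) (by simp)).congr_fun (fun t ht => ?_) measurableSet_Ioc
    simp [ht.2]
  · refine (integrableOn_Ioi_rpow_of_lt (by norm_num : (-2 : ℝ) < -1) one_pos).congr_fun
      (fun t ht => ?_) measurableSet_Ioi
    rw [if_neg (not_le.mpr (Set.mem_Ioi.mp ht))]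

/-- By the functional equation the integrand on (0, 1) also involves theta only at 1/t > 1. With k ≥
|Re s| + 2, its decay of order k bounds the integrand by a multiple of 1 on (0, 1) and of t^(-2)
beyond, uniformly in s. -/
lemma norm_Λ₀_thetaPair_le (τ : ℍ) {k : ℕ} {s : ℂ} (hs : |s.re| + 2 ≤ k) :
    ‖(thetaPair τ).Λ₀ s‖ ≤ thetaConst k * pairSum τ k := by
  have hk2 : 2 ≤ k := by exact_mod_cast (by linarith [abs_nonneg s.re] : (2 : ℝ) ≤ k)
  have hσ1 := le_abs_self s.re
  have hσ2 := neg_abs_le s.re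
  have hK : 0 ≤ (k.factorial : ℝ) * pairSum τ k :=
    mul_nonneg (Nat.cast_nonneg _) (pairSum_nonneg _ _)
  have key : ∀ t ∈ Set.Ioi (0 : ℝ), ‖(t : ℂ) ^ (s - 1) • (thetaPair τ).f_modif t‖ ≤
      (k.factorial * pairSum τ k) * if t ≤ 1 then (1 : ℝ) else t ^ (-2 : ℝ) := by
    intro t (ht : 0 < t)
    rw [norm_smul, Complex.norm_cpow_eq_rpow_re_of_pos ht, Complex.sub_re, Complex.one_re]
    rcases lt_trichotomy t 1 with h1 | rfl | h1
    · rw [thetaPair_f_modif_of_lt_one τ ht h1, Complex.norm_real, if_pos h1.le,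
        Real.norm_of_nonneg (mul_nonneg (inv_nonneg.mpr ht.le) (thetaZero_nonneg _ _))]
      have h := thetaZero_le τ hk2 (one_div_pos.mpr ht)
      have e : (1 / t) ^ (-(k : ℝ)) = t ^ (k : ℝ) := by
        rw [one_div, Real.inv_rpow ht.le, Real.rpow_neg ht.le, inv_inv]
      rw [e] at h
      calc t ^ (s.re - 1) * (t⁻¹ * thetaZero τ (1 / t))
          ≤ t ^ (s.re - 1) * (t⁻¹ * (k.factorial * t ^ (k : ℝ) * pairSum τ k)) := by gcongr
        _ = k.factorial * pairSum τ k * t ^ (s.re - 1 + -1 + k) := by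
            rw [Real.rpow_add ht, Real.rpow_add ht, Real.rpow_neg_one]; ring
        _ ≤ _ := by
            gcongr
            exact Real.rpow_le_one ht.le h1.le (by linarith)
    · simp [thetaPair_f_modif_one, hK]
    · rw [thetaPair_f_modif_of_one_lt τ h1, Complex.norm_real, if_neg (not_le.mpr h1),
        Real.norm_of_nonneg (thetaZero_nonneg _ _)]
      have h := thetaZero_le τ hk2 ht
      calc t ^ (s.re - 1) * thetaZero τ t
          ≤ t ^ (s.re - 1) * (k.factorial * t ^ (-(k : ℝ)) * pairSum τ k) := by gcongr
        _ = k.factorial * pairSum τ k * t ^ (s.re - 1 + -k) := by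
            rw [Real.rpow_add ht]; ring
        _ ≤ _ := by
            gcongr
            · exact h1.le
            · linarith
  rw [WeakFEPair.Λ₀, mellin]
  refine (norm_integral_le_of_norm_le (integrableOn_thetaBound.const_mul
    (k.factorial * pairSum τ k)) ?_).trans_eq ?_
  · exact (ae_restrict_iff' measurableSet_Ioi).mpr (.of_forall key)
  · rw [integral_const_mul, thetaConst]
    ring

lemma measurable_pairForm (v : Fin 2 → ℤ) : Measurable fun τ => pairForm τ v := by
  have : Continuous fun τ => pairForm τ v := by
    unfold pairForm
    have h1 : Continuous fun τ : ℍ => (τ : ℂ) := continuous_coe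
    have h2 : Continuous fun τ : ℍ => τ.im := continuous_im
    exact Continuous.div (by fun_prop) h2 fun τ => τ.im_pos.ne'
  exact this.measurable

lemma measurable_pairSum (k : ℕ) : Measurable fun τ => pairSum τ k :=
  Measurable.tsum fun v => (measurable_pairForm v).pow_const _

lemma measurable_thetaZero : Measurable fun p : ℍ × ℝ => thetaZero p.1 p.2 := by
  refine Measurable.tsum fun v => ?_
  unfold thetaTerm
  split_ifs
  · exact measurable_const
  · exact ((((measurable_pairForm v).comp measurable_fst).const_mul _).mul measurable_snd).exp

lemma measurable_Λ₀_thetaPair (s : ℂ) : StronglyMeasurable fun τ => (thetaPair τ).Λ₀ s := by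
  have hmod : Measurable fun p : ℍ × ℝ => (thetaPair p.1).f_modif p.2 := by
    have h1 : Measurable fun p : ℍ × ℝ => ((1 + thetaZero p.1 p.2 : ℝ) : ℂ) := by
      have := measurable_thetaZero
      fun_prop
    have e : (fun p : ℍ × ℝ => (thetaPair p.1).f_modif p.2) =
        ({p : ℍ × ℝ | p.2 ∈ Set.Ioi 1}.indicator fun p => ((1 + thetaZero p.1 p.2 : ℝ) : ℂ) - 1) +
        ({p : ℍ × ℝ | p.2 ∈ Set.Ioo 0 1}.indicator fun p =>
          ((1 + thetaZero p.1 p.2 : ℝ) : ℂ) - (1 * ((p.2 ^ (-(1 : ℝ)) : ℝ) : ℂ)) • 1) := by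
      funext p
      rfl
    rw [e]
    refine Measurable.add (Measurable.indicator ?_ ?_) (Measurable.indicator ?_ ?_)
    · exact h1.sub_const _
    · exact measurable_snd measurableSet_Ioi
    · refine h1.sub ?_
      simp only [smul_eq_mul, mul_one, one_mul]
      fun_prop
    · exact measurable_snd measurableSet_Ioo
  have : StronglyMeasurable fun p : ℍ × ℝ => (p.2 : ℂ) ^ (s - 1) • (thetaPair p.1).f_modif p.2 := by
    refine Measurable.stronglyMeasurable ?_
    simp only [smul_eq_mul]
    fun_prop
  exact this.integral_prod_right

/-- The entire function `s (1 - s) (1 - 2 s) Λ(τ, s)`, where `Λ` is the completed Eisenstein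
series. -/
def eisNum (τ : ℍ) (s : ℂ) : ℂ := (1 - 2 * s) * (s * (1 - s) * (thetaPair τ).Λ₀ s - 1)

/-- The entire function `s (1 - s) (1 - 2 s) 2 ξ(2 s)`, where `ξ` is the completed Riemann zeta
function. -/
def eisDen (s : ℂ) : ℂ := (1 - s) * (2 * s * (1 - 2 * s) * completedRiemannZeta₀ (2 * s) - 1)

lemma differentiable_eisNum (τ : ℍ) : Differentiable ℂ (eisNum τ) := by
  have := (thetaPair τ).differentiable_Λ₀
  unfold eisNum
  fun_prop

lemma differentiable_eisDen : Differentiable ℂ eisDen := by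
  have := differentiable_completedZeta₀
  unfold eisDen
  fun_prop

lemma stronglyMeasurable_eisNum (s : ℂ) : StronglyMeasurable fun τ => eisNum τ s := by
  have := measurable_Λ₀_thetaPair s
  unfold eisNum
  fun_prop

lemma eisDen_eq {s : ℂ} (h0 : s ≠ 0) (h1 : 1 - 2 * s ≠ 0) :
    eisDen s = s * (1 - s) * (1 - 2 * s) * 2 * completedRiemannZeta (2 * s) := by
  rw [eisDen, completedRiemannZeta_eq]
  have e1 : 2 * s * (1 / (2 * s)) = 1 := mul_one_div_cancel (by simpa using h0)
  have e2 : (1 - 2 * s) * (1 / (1 - 2 * s)) = 1 := mul_one_div_cancel h1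
  linear_combination (1 - s) * (1 - 2 * s) * e1 + 2 * s * (1 - s) * e2

lemma eisDen_ne_zero {s : ℂ} (hs : 1 < s.re) : eisDen s ≠ 0 := by
  have h0 : s ≠ 0 := fun h => by norm_num [h] at hs
  have h1 : 1 - s ≠ 0 := fun h => by
    have := congrArg Complex.re h
    simp at this; linarith
  have h2 : 1 - 2 * s ≠ 0 := fun h => by
    have := congrArg Complex.re h
    simp at this; linarith
  have h3 : riemannZeta (2 * s) ≠ 0 := riemannZeta_ne_zero_of_one_lt_re (by simp; linarith)
  have h4 : completedRiemannZeta (2 * s) ≠ 0 := fun h => by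
    rw [riemannZeta_def_of_ne_zero (by simpa using h0), h, zero_div] at h3
    exact h3 rfl
  rw [eisDen_eq h0 h2]
  simp [h0, h1, h2, h4]

/-- Termwise Mellin transform: each nonzero pair contributes π^(-s) Γ(s) times its power -s of the
form, and the Gamma factor is the one completing ζ(2s). -/
lemma Λ_thetaPair_eq (τ : ℍ) {s : ℂ} (hs : 1 < s.re) :
    (thetaPair τ).Λ s = 2 * completedRiemannZeta (2 * s) * eisensteinSeries τ s := by
  have hs0 : 0 < s.re := zero_lt_one.trans hs
  have h0 : s ≠ 0 := fun h => by norm_num [h] at hs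
  have hG : Complex.Gammaℝ (2 * s) ≠ 0 := Complex.Gammaℝ_ne_zero_of_re_pos (by simp; linarith)
  have hM := ((thetaPair τ).hasMellin (s := s) hs).2
  -- Coefficient 0 at the zero vector, because the constant term 1 of theta has been subtracted.
  have hS := hasSum_mellin_pi_mul (a := fun v : Fin 2 → ℤ => if v = 0 then (0 : ℂ) else 1)
    (q := pairForm τ) (F := fun t => (thetaPair τ).f t - (thetaPair τ).f₀) (s := s)
    (fun v => by
      by_cases hv : v = 0
      · simp [hv]
      · exact Or.inr (pairForm_pos τ hv)) hs0
    (fun t ht => by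
      have h := Complex.ofRealCLM.hasSum (summable_thetaTerm τ ht).hasSum
      have e : (thetaPair τ).f t - (thetaPair τ).f₀ = Complex.ofRealCLM (thetaZero τ t) := by
        simp [thetaPair]
      rw [e]
      refine h.congr_fun fun v => ?_
      unfold thetaTerm
      split_ifs <;> simp)
    ((summable_pairForm_rpow τ hs).of_nonneg_of_le
      (fun v => div_nonneg (norm_nonneg _) (Real.rpow_nonneg (pairForm_nonneg _ _) _)) fun v => by
        rw [Real.rpow_neg (pairForm_nonneg _ _), div_eq_mul_inv]
        refine mul_le_of_le_one_left (inv_nonneg.mpr (Real.rpow_nonneg (pairForm_nonneg _ _) _)) ?_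
        split_ifs <;> simp)
  rw [hM] at hS
  rw [← hS.tsum_eq]
  have e : ∀ v : Fin 2 → ℤ, (Real.pi : ℂ) ^ (-s) * Complex.Gamma s *
      (if v = 0 then (0 : ℂ) else 1) / (pairForm τ v : ℂ) ^ s =
      (Real.pi : ℂ) ^ (-s) * Complex.Gamma s * (1 / (pairForm τ v : ℂ) ^ s) := fun v => by
    by_cases hv : v = 0
    · simp [hv, h0]
    · simp [hv, div_eq_mul_inv]
  simp_rw [e]
  rw [tsum_mul_left, tsum_pairForm τ hs, riemannZeta_def_of_ne_zero (by simpa using h0)]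
  have hGe : (Real.pi : ℂ) ^ (-s) * Complex.Gamma s = Complex.Gammaℝ (2 * s) := by
    rw [Complex.Gammaℝ_def]
    congr 2 <;> ring
  rw [hGe]
  field_simp

lemma eisNum_eq (τ : ℍ) {s : ℂ} (hs : 1 < s.re) :
    eisNum τ s = eisDen s * eisensteinSeries τ s := by
  have h0 : s ≠ 0 := fun h => by norm_num [h] at hs
  have h1 : 1 - s ≠ 0 := fun h => by
    have := congrArg Complex.re h
    simp at this; linarith
  have h2 : 1 - 2 * s ≠ 0 := fun h => by
    have := congrArg Complex.re h
    simp at this; linarith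
  have h := Λ_thetaPair_eq τ hs
  rw [WeakFEPair.Λ] at h
  have e : (thetaPair τ).Λ₀ s = 2 * completedRiemannZeta (2 * s) * eisensteinSeries τ s +
      1 / s + 1 / (1 - s) := by
    rw [← h]
    simp only [thetaPair, smul_eq_mul, mul_one, Complex.ofReal_one]
    ring
  rw [eisDen_eq h0 h2, eisNum, e]
  field_simp
  ring

lemma norm_eisNum_le {k : ℕ} {R : ℝ} (hR : R + 2 ≤ k) (τ : ℍ) {s : ℂ} (hs : ‖s‖ ≤ R) :
    ‖eisNum τ s‖ ≤ (1 + 2 * R) * (R * (1 + R) * thetaConst k + 1) * (1 + pairSum τ k) := by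
  have hR0 : 0 ≤ R := (norm_nonneg s).trans hs
  have hre : |s.re| + 2 ≤ k := by linarith [Complex.abs_re_le_norm s]
  have h := norm_Λ₀_thetaPair_le τ hre
  have hp := pairSum_nonneg τ k
  have hc : 0 ≤ thetaConst k := by
    unfold thetaConst
    refine mul_nonneg (Nat.cast_nonneg _) (setIntegral_nonneg measurableSet_Ioi fun t ht => ?_)
    split_ifs
    exacts [zero_le_one, Real.rpow_nonneg (le_of_lt ht) _]
  have h1 : ‖1 - 2 * s‖ ≤ 1 + 2 * R := (norm_sub_le _ _).trans (by simp; linarith)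
  have h2 : ‖1 - s‖ ≤ 1 + R := (norm_sub_le _ _).trans (by simp; linarith)
  have h3 : ‖s * (1 - s) * (thetaPair τ).Λ₀ s - 1‖ ≤
      R * (1 + R) * (thetaConst k * pairSum τ k) + 1 := by
    refine (norm_sub_le _ _).trans ?_
    rw [norm_one, norm_mul, norm_mul]
    gcongr
  rw [eisNum, norm_mul, mul_assoc (1 + 2 * R)]
  refine mul_le_mul h1 (h3.trans ?_) (norm_nonneg _) (by positivity)
  have : 0 ≤ R * (1 + R) * thetaConst k := by positivity
  nlinarith

/-! ### The meromorphic continuation of the Eisenstein series -/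

/-- The difference has infinite order at one point, hence at every point of the connected plane.
Meromorphic functions in normal form are determined by their punctured germs, so even the values at
poles agree. -/
lemma meromorphicNFOn_univ_eq_of_eqOn {G H : ℂ → ℂ} (hG : MeromorphicNFOn G Set.univ)
    (hH : MeromorphicNFOn H Set.univ) {U : Set ℂ} (hU : IsOpen U) (hne : U.Nonempty)
    (h : Set.EqOn G H U) : G = H := by
  obtain ⟨u, hu⟩ := hne
  have hD : MeromorphicOn (G - H) Set.univ := hG.meromorphicOn.sub hH.meromorphicOn
  have hu' : meromorphicOrderAt (G - H) u = ⊤ := by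
    rw [meromorphicOrderAt_eq_top_iff]
    refine eventually_nhdsWithin_of_eventually_nhds ?_
    filter_upwards [hU.mem_nhds hu] with z hz
    rw [Pi.sub_apply, h hz, sub_self]
  funext z
  have hz : meromorphicOrderAt (G - H) z = ⊤ := by
    by_contra hz
    exact hD.meromorphicOrderAt_ne_top_of_isPreconnected isPreconnected_univ (Set.mem_univ z)
      (Set.mem_univ u) hz hu'
  rw [meromorphicOrderAt_eq_top_iff] at hz
  have hz' : G =ᶠ[𝓝[≠] z] H := by
    filter_upwards [hz] with w hw
    exact sub_eq_zero.mp hw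
  exact (((hG (Set.mem_univ z)).eventuallyEq_nhdsNE_iff_eventuallyEq_nhds
    (hH (Set.mem_univ z))).mp hz').eq_of_nhds

lemma isOpen_one_lt_re : IsOpen {s : ℂ | 1 < s.re} := isOpen_lt continuous_const Complex.continuous_re

lemma meromorphicOn_eisNum_div (τ : ℍ) :
    MeromorphicOn (fun s => eisNum τ s / eisDen s) Set.univ := fun s _ =>
  ((differentiable_eisNum τ).analyticAt s).meromorphicAt.div
    (differentiable_eisDen.analyticAt s).meromorphicAt

lemma toMeromorphicNFOn_eisNum_div (τ : ℍ) {s : ℂ} (hs : eisDen s ≠ 0) :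
    toMeromorphicNFOn (fun s => eisNum τ s / eisDen s) Set.univ s = eisNum τ s / eisDen s := by
  have h := (meromorphicOn_eisNum_div τ).toMeromorphicNFOn_eq_self_on_nhdsNE (Set.mem_univ s)
  have ha : AnalyticAt ℂ (fun s => eisNum τ s / eisDen s) s :=
    ((differentiable_eisNum τ).analyticAt s).div (differentiable_eisDen.analyticAt s) hs
  exact (((meromorphicNFOn_toMeromorphicNFOn _ _ (Set.mem_univ s)).eventuallyEq_nhdsNE_iff_eventuallyEq_nhds
    ha.meromorphicNFAt).mp h).eq_of_nhds

lemma eisenstein_eq_eisensteinSeries (τ : ℍ) {s : ℂ} (hs : 1 < s.re) :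
    eisenstein τ s = eisensteinSeries τ s :=
  meromorphicContinuation_eqOn {s : ℂ | 1 < s.re} (eisensteinSeries τ) hs

/-- The quotient shows that a continuation exists, so `meromorphicContinuation` does not fall back
to its default; uniqueness identifies the chosen one. -/
lemma eisenstein_eq_toMeromorphicNFOn (τ : ℍ) :
    eisenstein τ = toMeromorphicNFOn (fun s => eisNum τ s / eisDen s) Set.univ := by
  have hE : Set.EqOn (toMeromorphicNFOn (fun s => eisNum τ s / eisDen s) Set.univ)
      (eisensteinSeries τ) {s : ℂ | 1 < s.re} := fun s hs => by
    rw [toMeromorphicNFOn_eisNum_div τ (eisDen_ne_zero hs), eisNum_eq τ hs,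
      mul_div_cancel_left₀ _ (eisDen_ne_zero hs)]
  have h : ∃ G : ℂ → ℂ, MeromorphicNFOn G Set.univ ∧
      Set.EqOn G (eisensteinSeries τ) {s : ℂ | 1 < s.re} :=
    ⟨_, meromorphicNFOn_toMeromorphicNFOn _ _, hE⟩
  have hG : MeromorphicNFOn (eisenstein τ) Set.univ := by
    rw [eisenstein, meromorphicContinuation, dif_pos h]
    exact h.choose_spec.1
  refine meromorphicNFOn_univ_eq_of_eqOn hG (meromorphicNFOn_toMeromorphicNFOn _ _)
    isOpen_one_lt_re ⟨2, by simp⟩ fun s hs => ?_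
  rw [hE hs, eisenstein_eq_eisensteinSeries τ hs]

lemma eisenstein_eq_div (τ : ℍ) {s : ℂ} (hs : eisDen s ≠ 0) :
    eisenstein τ s = eisNum τ s / eisDen s := by
  rw [eisenstein_eq_toMeromorphicNFOn, toMeromorphicNFOn_eisNum_div τ hs]

lemma eventually_eisDen_ne_zero (s : ℂ) : ∀ᶠ z in 𝓝[≠] s, eisDen z ≠ 0 := by
  have hA : AnalyticOnNhd ℂ eisDen Set.univ := fun z _ => differentiable_eisDen.analyticAt z
  rcases (hA s (Set.mem_univ s)).eventually_eq_zero_or_eventually_ne_zero with h | h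
  · have := hA.eqOn_zero_of_preconnected_of_eventuallyEq_zero isPreconnected_univ (Set.mem_univ s) h
    exact absurd (this (Set.mem_univ 2)) (eisDen_ne_zero (by simp))
  · exact h

/-! ### The pair sum as an invariant majorant -/

lemma hasSum_strip (τ : ℍ) {s : ℂ} (hs : 1 < s.re) :
    HasSum (fun p : modularAut => strip.indicator (fun z : ℍ => (z.im : ℂ) ^ s) (p • τ))
      (eisenstein τ s) := by
  rw [eisenstein_eq_eisensteinSeries τ hs, ← hasSum_coset_iff (fun y => (y : ℂ) ^ s) τ]
  exact (tsum_coprime_pairForm τ hs).1.hasSum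

/-- As a multiple of the Eisenstein series at s = k, the pair sum inherits invariance under the
group. -/
lemma ofReal_pairSum (τ : ℍ) {k : ℕ} (hk : 2 ≤ k) :
    (pairSum τ k : ℂ) = 2 * riemannZeta (2 * k) * eisenstein τ k := by
  have hk' : 1 < ((k : ℂ)).re := by simpa using (by omega : 1 < k)
  rw [eisenstein_eq_eisensteinSeries τ hk', ← tsum_pairForm τ hk', pairSum, Complex.ofReal_tsum]
  refine tsum_congr fun v => ?_
  rw [Real.rpow_neg (pairForm_nonneg τ v), Complex.ofReal_inv,
    Complex.ofReal_cpow (pairForm_nonneg τ v), one_div, Complex.ofReal_natCast]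

lemma eisenstein_smul (p : modularAut) (τ : ℍ) {s : ℂ} (hs : 1 < s.re) :
    eisenstein (p • τ) s = eisenstein τ s := by
  rw [← (hasSum_strip (p • τ) hs).tsum_eq, ← (hasSum_strip τ hs).tsum_eq,
    ← (Equiv.mulRight p).tsum_eq fun q : modularAut =>
      strip.indicator (fun z : ℍ => (z.im : ℂ) ^ s) (q • τ)]
  simp only [Equiv.coe_mulRight, mul_smul]

lemma pairSum_smul (p : modularAut) (τ : ℍ) {k : ℕ} (hk : 2 ≤ k) :
    pairSum (p • τ) k = pairSum τ k := by
  have hk' : 1 < ((k : ℂ)).re := by simpa using (by omega : 1 < k)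
  rw [← Complex.ofReal_inj, ofReal_pairSum _ hk, ofReal_pairSum _ hk, eisenstein_smul p τ hk']

lemma half_le_r_of_mem_fd {τ : ℍ} (hτ : τ ∈ ModularGroup.fd) : 1 / 2 ≤ EisensteinSeries.r τ := by
  have h1 := ModularGroup.three_le_four_mul_im_sq_of_mem_fd hτ
  have h2 : |τ.re| ≤ 1 / 2 := hτ.2
  have h3 : τ.re ^ 2 ≤ 1 / 4 := by
    rw [← sq_abs]
    nlinarith [abs_nonneg τ.re]
  have h4 := τ.im_pos
  refine le_min (by nlinarith) (Real.le_sqrt_of_sq_le ?_)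
  rw [EisensteinSeries.r1, le_div_iff₀ (by positivity)]
  nlinarith

/-- On the standard domain |mτ+n| is at least half the sup norm of (m, n), uniformly in τ, so only
the factor (Im τ)^k is left. -/
lemma pairSum_le_of_mem_fd {k : ℕ} (hk : 2 ≤ k) :
    ∃ C : ℝ, ∀ τ ∈ ModularGroup.fd, pairSum τ k ≤ C * τ.im ^ k := by
  have hk' : (1 : ℝ) < k := by exact_mod_cast hk
  have hs : Summable fun v : Fin 2 → ℤ => ‖v‖ ^ (-(2 * k : ℝ)) :=
    EisensteinSeries.summable_one_div_norm_rpow (k := 2 * k) (by linarith)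
  refine ⟨(1 / 2 : ℝ) ^ (-(2 * k : ℝ)) * ∑' v : Fin 2 → ℤ, ‖v‖ ^ (-(2 * k : ℝ)), fun τ hτ => ?_⟩
  rw [mul_right_comm, ← tsum_mul_left, pairSum]
  refine Summable.tsum_le_tsum (fun v => ?_) (summable_pairForm_nat τ hk) (hs.mul_left _)
  refine (rpow_neg_pairForm_le τ (by linarith) v).trans ?_
  rw [Real.rpow_natCast, mul_comm ((1 / 2 : ℝ) ^ _)]
  have := half_le_r_of_mem_fd hτ
  have h2 : EisensteinSeries.r τ ^ (-(2 * k : ℝ)) ≤ (1 / 2 : ℝ) ^ (-(2 * k : ℝ)) :=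
    Real.rpow_le_rpow_of_nonpos (by norm_num) this (by linarith)
  have h4 := τ.im_pos.le
  gcongr

/-! ### The hyperbolic measure in coordinates -/

/-- The real and the imaginary part of a point of the upper half-plane. -/
def coords (τ : ℍ) : ℝ × ℝ := (τ.re, τ.im)

lemma measurableEmbedding_coords : MeasurableEmbedding coords :=
  Complex.measurableEquivRealProd.measurableEmbedding.comp measurableEmbedding_coe

/-- The density of the hyperbolic measure. -/
def hypDensity (p : ℝ × ℝ) : NNReal := (1 / ‖p.2‖₊) ^ 2

lemma measurable_hypDensity : Measurable hypDensity := by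
  unfold hypDensity
  fun_prop

lemma map_coords_volume : Measure.map coords (volume : Measure ℍ) =
    ((volume : Measure (ℝ × ℝ)).restrict (Set.univ ×ˢ Set.Ioi 0)).withDensity
      (fun p => (hypDensity p : ENNReal)) := by
  ext S hS
  rw [measurableEmbedding_coords.map_apply, volume_eq_lintegral, withDensity_apply _ hS,
    Measure.restrict_restrict hS,
    ← Complex.volume_preserving_equiv_real_prod.setLIntegral_comp_preimage_emb
      Complex.measurableEquivRealProd.measurableEmbedding]
  congr 2
  ext z
  constructor
  · rintro ⟨τ, hτ, rfl⟩
    exact ⟨hτ, Set.mem_univ _, τ.im_pos⟩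
  · rintro ⟨h1, -, h2⟩
    exact ⟨⟨z, h2⟩, h1, rfl⟩

/-- The point of the upper half-plane with the given coordinates. -/
abbrev ofCoords (u v : ℝ) : ℍ := ofComplex (u + v * Complex.I)

lemma ofCoords_eq {u v : ℝ} (hv : 0 < v) :
    ofCoords u v = ⟨u + v * Complex.I, by simpa using hv⟩ := by
  exact ofComplex_apply_of_im_pos (by simpa using hv)

lemma re_ofCoords {u v : ℝ} (hv : 0 < v) : (ofCoords u v).re = u := by
  rw [ofCoords_eq hv]
  change ((u : ℂ) + v * Complex.I).re = u
  simp

lemma im_ofCoords {u v : ℝ} (hv : 0 < v) : (ofCoords u v).im = v := by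
  rw [ofCoords_eq hv]
  change ((u : ℂ) + v * Complex.I).im = v
  simp

lemma coe_ofCoords {u v : ℝ} (hv : 0 < v) : (ofCoords u v : ℂ) = u + v * Complex.I := by
  rw [ofCoords_eq hv]

lemma ofCoords_coords (τ : ℍ) : ofCoords τ.re τ.im = τ := by
  refine UpperHalfPlane.ext ?_
  rw [coe_ofCoords τ.im_pos]
  exact Complex.re_add_im (τ : ℂ)

/-- The set of points with coordinates in the given sets. -/
def rect (A B : Set ℝ) : Set ℍ := {τ | τ.re ∈ A ∧ τ.im ∈ B}

lemma setLIntegral_rect {A B : Set ℝ} (hA : MeasurableSet A) (hB : MeasurableSet B)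
    (hB0 : B ⊆ Set.Ioi 0) {φ : ℝ × ℝ → ENNReal} (hφ : Measurable φ) :
    ∫⁻ τ in rect A B, φ (coords τ) =
      ∫⁻ v in B, ∫⁻ u in A, hypDensity (u, v) * φ (u, v) := by
  have hpre : rect A B = coords ⁻¹' (A ×ˢ B) := rfl
  rw [hpre, ← measurableEmbedding_coords.lintegral_map, ← measurableEmbedding_coords.restrict_map,
    map_coords_volume, restrict_withDensity (hA.prod hB), Measure.restrict_restrict (hA.prod hB),
    lintegral_withDensity_eq_lintegral_mul _ measurable_hypDensity.coe_nnreal_ennreal hφ,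
    Set.prod_inter_prod, Set.inter_univ, Set.inter_eq_left.mpr hB0, Measure.volume_eq_prod,
    ← Measure.prod_restrict, lintegral_prod_symm]
  · rfl
  · exact (measurable_hypDensity.coe_nnreal_ennreal.mul hφ).aemeasurable

lemma setIntegral_rect {A B : Set ℝ} (hA : MeasurableSet A) (hB : MeasurableSet B)
    (hB0 : B ⊆ Set.Ioi 0) {φ : ℍ → ℂ} (hφ : IntegrableOn φ (rect A B)) :
    ∫ τ in rect A B, φ τ = ∫ v in B, ∫ u in A, ((v ^ 2)⁻¹ : ℝ) • φ (ofCoords u v) := by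
  have hpre : rect A B = coords ⁻¹' (A ×ˢ B) := rfl
  have hφ' : φ = (fun p : ℝ × ℝ => φ (ofCoords p.1 p.2)) ∘ coords := by
    funext τ
    exact congrArg φ (ofCoords_coords τ).symm
  rw [hpre] at hφ ⊢
  rw [hφ'] at hφ
  have hφ2 := hφ
  rw [IntegrableOn, ← measurableEmbedding_coords.integrable_map_iff,
    ← measurableEmbedding_coords.restrict_map, map_coords_volume, restrict_withDensity (hA.prod hB),
    Measure.restrict_restrict (hA.prod hB),
    integrable_withDensity_iff_integrable_smul measurable_hypDensity,
    Set.prod_inter_prod, Set.inter_univ, Set.inter_eq_left.mpr hB0, Measure.volume_eq_prod,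
    ← Measure.prod_restrict] at hφ2
  conv_lhs => rw [hφ']
  simp only [Function.comp_def]
  rw [← measurableEmbedding_coords.integral_map (fun p : ℝ × ℝ => φ (ofCoords p.1 p.2)),
    ← measurableEmbedding_coords.restrict_map, map_coords_volume, restrict_withDensity (hA.prod hB),
    Measure.restrict_restrict (hA.prod hB), integral_withDensity_eq_integral_smul measurable_hypDensity,
    Set.prod_inter_prod, Set.inter_univ, Set.inter_eq_left.mpr hB0, Measure.volume_eq_prod,
    ← Measure.prod_restrict, integral_prod_symm _ hφ2]
  refine setIntegral_congr_fun hB fun v hv => ?_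
  refine setIntegral_congr_fun hA fun u _ => ?_
  have : ((hypDensity (u, v) : NNReal) : ℝ) = (v ^ 2)⁻¹ := by
    simp [hypDensity]
  rw [NNReal.smul_def, this]

lemma volume_fd_lt_top : volume ModularGroup.fd < ⊤ := by
  have hsub : ModularGroup.fd ⊆ rect (Set.Icc (-1) 1) (Set.Ioi (1 / 2)) := fun τ hτ => by
    have h1 := ModularGroup.three_le_four_mul_im_sq_of_mem_fd hτ
    have h2 := abs_le.mp (hτ.2 : |τ.re| ≤ 1 / 2)
    refine ⟨⟨by linarith [h2.1], by linarith [h2.2]⟩, ?_⟩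
    have := τ.im_pos
    change 1 / 2 < τ.im
    nlinarith
  refine (measure_mono hsub).trans_lt ?_
  have h := setLIntegral_rect (A := Set.Icc (-1) 1) (B := Set.Ioi (1 / 2)) measurableSet_Icc
    measurableSet_Ioi (Set.Ioi_subset_Ioi (by norm_num)) (φ := fun _ => 1) measurable_const
  rw [setLIntegral_one] at h
  rw [h]
  have hd : ∀ u v : ℝ, (hypDensity (u, v) : ENNReal) * 1 = ENNReal.ofReal (v ^ (-2 : ℝ)) := by
    intro u v
    rw [mul_one, hypDensity, ← ENNReal.ofReal_coe_nnreal]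
    congr 1
    rw [show (-2 : ℝ) = ((-2 : ℤ) : ℝ) by norm_num, Real.rpow_intCast]
    simp [zpow_neg]
  simp_rw [hd, setLIntegral_const, Real.volume_Icc]
  rw [lintegral_mul_const _ (by fun_prop)]
  refine ENNReal.mul_lt_top ?_ (by simp)
  have := (integrableOn_Ioi_rpow_of_lt (by norm_num : (-2 : ℝ) < -1)
    (by norm_num : (0 : ℝ) < 1 / 2)).2
  refine lt_of_le_of_lt (lintegral_mono fun v => ?_) this
  rw [← ofReal_norm]
  exact ENNReal.ofReal_le_ofReal (le_abs_self _)

/-! ### Local integrability of the logarithm of a meromorphic function -/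

/-- In polar coordinates the Jacobian r absorbs the singularity, as r |log r| ≤ 1 on (0, 1). -/
lemma integrableOn_log_norm_ball : IntegrableOn (fun z : ℂ => Real.log ‖z‖) (Metric.ball 0 1) := by
  refine ⟨(Measurable.aestronglyMeasurable (by fun_prop)), ?_⟩
  rw [HasFiniteIntegral, ← lintegral_indicator Metric.isOpen_ball.measurableSet,
    ← Complex.lintegral_comp_polarCoord_symm]
  have hle : ∀ p ∈ polarCoord.target, ENNReal.ofReal p.1 •
      (Metric.ball (0 : ℂ) 1).indicator (fun z => ‖Real.log ‖z‖‖ₑ) (Complex.polarCoord.symm p) ≤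
      (Set.Ioo 0 1 ×ˢ Set.Ioo (-Real.pi) Real.pi).indicator 1 p := by
    rintro ⟨r, θ⟩ ⟨hr, hθ⟩
    have hr0 : 0 < r := hr
    have hn : ‖Complex.polarCoord.symm (r, θ)‖ = r := by
      rw [Complex.norm_polarCoord_symm, abs_of_pos hr0]
    by_cases h1 : r < 1
    · rw [Set.indicator_of_mem (by rw [mem_ball_zero_iff, hn]; exact h1), hn,
        Set.indicator_of_mem (Set.mk_mem_prod (Set.mem_Ioo.mpr ⟨hr0, h1⟩) hθ), ← ofReal_norm, smul_eq_mul,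
        ← ENNReal.ofReal_mul hr0.le, Pi.one_apply, ENNReal.ofReal_le_one]
      have := Real.abs_log_mul_self_lt r hr0 h1.le
      rw [abs_mul, abs_of_pos hr0] at this
      rw [Real.norm_eq_abs, mul_comm]
      exact this.le
    · rw [Set.indicator_of_notMem (by rw [mem_ball_zero_iff, hn]; exact h1)]
      simp
  refine (setLIntegral_mono' polarCoord.open_target.measurableSet hle).trans_lt ?_
  refine (setLIntegral_le_lintegral _ _).trans_lt ?_
  rw [lintegral_indicator_one (measurableSet_Ioo.prod measurableSet_Ioo), Measure.volume_eq_prod,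
    Measure.prod_prod, Real.volume_Ioo, Real.volume_Ioo]
  exact ENNReal.mul_lt_top ENNReal.ofReal_lt_top ENNReal.ofReal_lt_top

lemma integrableAtFilter_log_norm_sub (z₀ : ℂ) :
    IntegrableAtFilter (fun z : ℂ => Real.log ‖z - z₀‖) (𝓝 z₀) := by
  refine ⟨Metric.ball z₀ 1, Metric.ball_mem_nhds _ one_pos, ?_⟩
  have h := (measurePreserving_sub_right (volume : Measure ℂ) z₀).integrableOn_comp_preimage
    (measurableEmbedding_subRight z₀) (f := fun z : ℂ => Real.log ‖z‖) (s := Metric.ball 0 1)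
  have h2 : (fun z : ℂ => z - z₀) ⁻¹' Metric.ball 0 1 = Metric.ball z₀ 1 := by
    ext z
    simp [dist_eq_norm]
  rw [h2] at h
  exact h.mpr integrableOn_log_norm_ball

/-- Factoring g = (z - z₀)^n G with G(z₀) ≠ 0 leaves n log|z - z₀| plus a continuous function. -/
lemma integrableAtFilter_log_norm {g : ℂ → ℂ} {z₀ : ℂ} (hg : MeromorphicAt g z₀)
    (ho : meromorphicOrderAt g z₀ ≠ ⊤) :
    IntegrableAtFilter (fun z : ℂ => Real.log ‖g z‖) (𝓝 z₀) := by
  obtain ⟨G, hG, hG0, hgG⟩ := (meromorphicOrderAt_ne_top_iff hg).mp ho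
  set n := (meromorphicOrderAt g z₀).untop₀
  have hlogG : IntegrableAtFilter (fun z : ℂ => Real.log ‖G z‖) (𝓝 z₀) := by
    have hc : ∀ᶠ z in 𝓝 z₀, ContinuousAt (fun z : ℂ => Real.log ‖G z‖) z := by
      filter_upwards [hG.eventually_analyticAt, hG.continuousAt.eventually_ne hG0] with z h1 h2
      exact h1.continuousAt.norm.log (norm_ne_zero_iff.mpr h2)
    obtain ⟨ε, hε, hball⟩ := Metric.nhds_basis_closedBall.mem_iff.mp hc
    refine ⟨Metric.closedBall z₀ ε, Metric.closedBall_mem_nhds _ hε, ?_⟩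
    exact ContinuousOn.integrableOn_compact (isCompact_closedBall _ _)
      fun z hz => ContinuousAt.continuousWithinAt (Set.mem_ofPred_eq.mp (hball hz))
  have hsum := ((integrableAtFilter_log_norm_sub z₀).smul (n : ℝ)).add hlogG
  obtain ⟨S, hS, hint⟩ := hsum
  rw [eventuallyEq_nhdsWithin_iff] at hgG
  have hGne := hG.continuousAt.eventually_ne hG0
  have hV : S ∩ {z | z ∈ ({z₀} : Set ℂ)ᶜ → g z = (z - z₀) ^ n • G z} ∩ {z | G z ≠ 0} ∈ 𝓝 z₀ :=
    inter_mem (inter_mem hS hgG) hGne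
  obtain ⟨V, hVsub, hVo, hzV⟩ := mem_nhds_iff.mp hV
  refine ⟨V, hVo.mem_nhds hzV, ?_⟩
  refine (hint.mono_set fun z hz => (hVsub hz).1.1).congr ?_
  -- The factorization says nothing about the value at z₀, which is a null set.
  have h0 : ∀ᵐ z ∂(volume.restrict V), z ≠ z₀ :=
    ae_restrict_of_ae (compl_mem_ae_iff.mpr (measure_singleton z₀))
  filter_upwards [h0, ae_restrict_mem hVo.measurableSet] with z hz hzV
  have h1 := (hVsub hzV).1.2 hz
  have h2 : ‖z - z₀‖ ≠ 0 := norm_ne_zero_iff.mpr (sub_ne_zero.mpr hz)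
  rw [h1, norm_smul, norm_zpow, Real.log_mul (zpow_ne_zero _ h2) (norm_ne_zero_iff.mpr (hVsub hzV).2),
    Real.log_zpow]
  rfl

lemma integrableAtFilter_comp_coe {g : ℂ → ℝ} {τ : ℍ} (h : IntegrableAtFilter g (𝓝 (τ : ℂ))) :
    IntegrableAtFilter (fun z : ℍ => g z) (𝓝 τ) := by
  obtain ⟨S, hS, hint⟩ := h
  have hτ := τ.im_pos
  obtain ⟨V, hVsub, hVo, hV⟩ := mem_nhds_iff.mp hS
  have hA : MeasurableSet (((↑) : ℍ → ℂ) ⁻¹' V ∩ {z : ℍ | τ.im / 2 < z.im}) :=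
    (hVo.preimage continuous_coe).measurableSet.inter
      (isOpen_lt continuous_const continuous_im).measurableSet
  refine ⟨((↑) : ℍ → ℂ) ⁻¹' V ∩ {z : ℍ | τ.im / 2 < z.im}, inter_mem
    (continuous_coe.continuousAt.preimage_mem_nhds (hVo.mem_nhds hV))
    ((isOpen_lt continuous_const continuous_im).mem_nhds (by change τ.im / 2 < τ.im; linarith)), ?_⟩
  have h1 : IntegrableOn (fun z : ℍ => g z) (((↑) : ℍ → ℂ) ⁻¹' V)
      ((volume : Measure ℂ).comap UpperHalfPlane.coe) := by
    refine (measurableEmbedding_coe.integrableOn_map_iff (f := g)).mp ?_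
    rw [measurableEmbedding_coe.map_comap]
    exact (hint.mono_set hVsub).mono_measure Measure.restrict_le_self
  have h2 := h1.mono_set (s := ((↑) : ℍ → ℂ) ⁻¹' V ∩ {z : ℍ | τ.im / 2 < z.im})
    Set.inter_subset_left
  -- The supremum of the hyperbolic density on Im > Im τ / 2.
  set c : NNReal := (1 / ⟨τ.im / 2, (half_pos hτ).le⟩) ^ 2 with hc
  refine (Integrable.smul_measure_nnreal h2 (c := c)).mono_measure ?_
  rw [volume_def, restrict_withDensity hA]
  refine Measure.le_iff.mpr fun s hs => ?_
  rw [withDensity_apply _ hs, Measure.smul_apply]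
  refine (setLIntegral_mono_ae (g := fun _ => (c : ENNReal)) aemeasurable_const ?_).trans_eq ?_
  · filter_upwards [ae_restrict_mem hA] with z hz _
    rw [ENNReal.coe_le_coe, hc]
    refine pow_le_pow_left' ?_ 2
    refine div_le_div_of_nonneg_left zero_le_one (half_pos hτ) (le_of_lt hz.2)
  · rw [setLIntegral_const]
    rfl

/-! ### Meromorphic modular functions with value `1` at the cusp -/

namespace IsMeromorphicModularForm

variable {f : ℍ → ℂ}

lemma apply_smul (hf : IsMeromorphicModularForm 0 f) (γ : SL(2, ℤ)) (τ : ℍ) :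
    f (γ • τ) = f τ := by
  have h := congrFun (hf.slash_eq γ) τ
  rwa [ModularForm.SL_slash_apply, neg_zero, zpow_zero, mul_one] at h

lemma apply_aut_smul (hf : IsMeromorphicModularForm 0 f) (p : modularAut) (τ : ℍ) :
    f (p • τ) = f τ := by
  obtain ⟨γ, rfl⟩ := toAut_surjective p
  exact hf.apply_smul γ τ

lemma periodic (hf : IsMeromorphicModularForm 0 f) :
    Function.Periodic (f ∘ ofComplex) ((1 : ℝ) : ℂ) := by
  intro w
  by_cases! hw : 0 < Complex.im w
  · have hw' : 0 < Complex.im (w + (1 : ℝ)) := by simpa using hw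
    simp only [Function.comp_apply, ofComplex_apply_of_im_pos hw', ofComplex_apply_of_im_pos hw]
    rw [← hf.apply_smul ModularGroup.T ⟨w, hw⟩, modular_T_smul]
    congr 1
    ext
    simp [add_comm]
  -- Off the upper half-plane `ofComplex` takes one constant value.
  · have hw' : Complex.im (w + (1 : ℝ)) ≤ 0 := by simpa using hw
    rw [Function.comp_apply, Function.comp_apply, ofComplex_apply_eq_of_im_nonpos hw' hw]

lemma cuspFunction_qParam (hf : IsMeromorphicModularForm 0 f) (τ : ℍ) :
    cuspFunction 1 f (Function.Periodic.qParam 1 τ) = f τ :=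
  eq_cuspFunction τ one_ne_zero hf.periodic

lemma cuspFunction_comp_qParam (hf : IsMeromorphicModularForm 0 f) (τ : ℍ) :
    cuspFunction 1 f ∘ Function.Periodic.qParam 1 =ᶠ[𝓝 (τ : ℂ)] f ∘ ofComplex := by
  filter_upwards [isOpen_upperHalfPlaneSet.mem_nhds τ.im_pos] with z hz
  have := hf.cuspFunction_qParam ⟨z, hz⟩
  rw [Function.comp_apply, Function.comp_apply, ofComplex_apply_of_im_pos hz, ← this]

end IsMeromorphicModularForm

lemma analyticAt_qParam (z : ℂ) : AnalyticAt ℂ (Function.Periodic.qParam 1) z :=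
  (Function.Periodic.differentiable_qParam (h := 1)).analyticAt z

lemma deriv_qParam_ne_zero (z : ℂ) : deriv (Function.Periodic.qParam 1) z ≠ 0 := by
  have h : HasDerivAt (Function.Periodic.qParam 1)
      (Complex.exp (2 * Real.pi * Complex.I * z / (1 : ℝ)) *
        (2 * Real.pi * Complex.I * 1 / (1 : ℝ))) z :=
    (((hasDerivAt_id z).const_mul (2 * Real.pi * Complex.I)).div_const _).cexp
  rw [h.deriv]
  simp [Real.pi_ne_zero]

lemma exists_qParam_eq {q : ℂ} (h0 : q ≠ 0) (h1 : ‖q‖ < 1) :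
    ∃ τ : ℍ, Function.Periodic.qParam 1 τ = q :=
  ⟨⟨Function.Periodic.invQParam 1 q,
    Function.Periodic.im_invQParam_pos_of_norm_lt_one one_pos h1 h0⟩,
    Function.Periodic.qParam_right_inv one_ne_zero h0⟩

namespace IsMeromorphicModularForm

variable {f : ℍ → ℂ}

/-- q has nowhere vanishing derivative in τ, so it is a local coordinate and preserves orders. -/
lemma meromorphicOrderAt_cuspFunction (hf : IsMeromorphicModularForm 0 f) (τ : ℍ) :
    meromorphicOrderAt (cuspFunction 1 f) (Function.Periodic.qParam 1 τ) =
      meromorphicOrderAt (f ∘ ofComplex) τ := by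
  rw [← meromorphicOrderAt_comp_of_deriv_ne_zero (analyticAt_qParam _) (deriv_qParam_ne_zero _)]
  exact meromorphicOrderAt_congr ((hf.cuspFunction_comp_qParam τ).filter_mono nhdsWithin_le_nhds)

lemma meromorphicOn_cuspFunction (hf : IsMeromorphicModularForm 0 f) :
    MeromorphicOn (cuspFunction 1 f) (Metric.ball 0 1) := by
  intro q hq
  rcases eq_or_ne q 0 with rfl | h0
  · exact hf.meromorphicAt_cusp
  · obtain ⟨τ, rfl⟩ := exists_qParam_eq h0 (mem_ball_zero_iff.mp hq)
    rw [← meromorphicAt_comp_iff_of_deriv_ne_zero (analyticAt_qParam _) (deriv_qParam_ne_zero _)]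
    exact (MeromorphicAt.meromorphicAt_congr
      ((hf.cuspFunction_comp_qParam τ).filter_mono nhdsWithin_le_nhds)).mpr
      (hf.meromorphicOn τ τ.im_pos)

lemma tendsto_cuspFunction (hf_inf : Tendsto f atImInfty (𝓝 1)) :
    Tendsto (cuspFunction 1 f) (𝓝[≠] 0) (𝓝 1) := by
  have h := (hf_inf.comp tendsto_comap_im_ofComplex).comp
    (Function.Periodic.invQParam_tendsto one_pos)
  refine h.congr' ?_
  filter_upwards [self_mem_nhdsWithin] with q hq
  exact (Function.Periodic.cuspFunction_eq_of_nonzero 1 (f ∘ ofComplex) hq).symm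

lemma meromorphicOrderAt_cuspFunction_zero (hf : IsMeromorphicModularForm 0 f)
    (hf_inf : Tendsto f atImInfty (𝓝 1)) : meromorphicOrderAt (cuspFunction 1 f) 0 = 0 :=
  (tendsto_ne_zero_iff_meromorphicOrderAt_eq_zero hf.meromorphicAt_cusp).mp
    ⟨1, one_ne_zero, tendsto_cuspFunction hf_inf⟩

lemma meromorphicTrailingCoeffAt_cuspFunction (hf : IsMeromorphicModularForm 0 f)
    (hf_inf : Tendsto f atImInfty (𝓝 1)) : meromorphicTrailingCoeffAt (cuspFunction 1 f) 0 = 1 := by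
  have h := hf.meromorphicAt_cusp.tendsto_nhds_meromorphicTrailingCoeffAt
  rw [hf.meromorphicOrderAt_cuspFunction_zero hf_inf] at h
  have h2 : ((fun x : ℂ => x - 0) ^ (-(0 : WithTop ℤ).untop₀) • cuspFunction 1 f) =
      cuspFunction 1 f := by
    simp
  rw [h2] at h
  exact tendsto_nhds_unique h (tendsto_cuspFunction hf_inf)

/-- The order at q = 0 is 0 because the limit there is 1, and finiteness spreads over the connected
disc. Hence `ordAt` never takes the default value of `untop₀`. -/
lemma meromorphicOrderAt_cuspFunction_ne_top (hf : IsMeromorphicModularForm 0 f)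
    (hf_inf : Tendsto f atImInfty (𝓝 1)) {q : ℂ} (hq : ‖q‖ < 1) :
    meromorphicOrderAt (cuspFunction 1 f) q ≠ ⊤ := by
  refine hf.meromorphicOn_cuspFunction.meromorphicOrderAt_ne_top_of_isPreconnected
    (convex_ball (0 : ℂ) 1).isPreconnected (Metric.mem_ball_self one_pos)
    (mem_ball_zero_iff.mpr hq) ?_
  rw [hf.meromorphicOrderAt_cuspFunction_zero hf_inf]
  exact WithTop.zero_ne_top

lemma meromorphicOrderAt_ne_top (hf : IsMeromorphicModularForm 0 f)
    (hf_inf : Tendsto f atImInfty (𝓝 1)) (τ : ℍ) :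
    meromorphicOrderAt (f ∘ ofComplex) τ ≠ ⊤ := by
  rw [← hf.meromorphicOrderAt_cuspFunction τ]
  exact hf.meromorphicOrderAt_cuspFunction_ne_top hf_inf
    (Function.Periodic.norm_qParam_lt_one one_pos τ.im_pos)

lemma ordAt_smul (hf : IsMeromorphicModularForm 0 f) (γ : SL(2, ℤ)) (τ : ℍ) :
    ordAt f (γ • τ) = ordAt f τ := by
  have hdet : (0 : ℝ) < (Matrix.SpecialLinearGroup.mapGL ℝ γ).val.det := by
    rw [← Matrix.GeneralLinearGroup.val_det_apply, Matrix.SpecialLinearGroup.det_mapGL]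
    exact one_pos
  have h := meromorphicOrderAt_comp_smul (f := f) (τ := τ) hdet
  have h2 : (fun z => f (Matrix.SpecialLinearGroup.mapGL ℝ γ • ofComplex z)) = f ∘ ofComplex :=
    funext fun z => hf.apply_smul γ (ofComplex z)
  rw [h2] at h
  rw [ordAt, ordAt, h]
  rfl

lemma ordAt_aut_smul (hf : IsMeromorphicModularForm 0 f) (p : modularAut) (τ : ℍ) :
    ordAt f (p • τ) = ordAt f τ := by
  obtain ⟨γ, rfl⟩ := toAut_surjective p
  exact hf.ordAt_smul γ τ

lemma locallyIntegrable_log_norm (hf : IsMeromorphicModularForm 0 f)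
    (hf_inf : Tendsto f atImInfty (𝓝 1)) : LocallyIntegrable fun τ => Real.log ‖f τ‖ := by
  intro τ
  have h := integrableAtFilter_comp_coe (integrableAtFilter_log_norm (hf.meromorphicOn τ τ.im_pos)
    (hf.meromorphicOrderAt_ne_top hf_inf τ))
  simpa using h

end IsMeromorphicModularForm

lemma abs_log_norm_le {w : ℂ} (hw : ‖w - 1‖ ≤ 1 / 2) : |Real.log ‖w‖| ≤ 2 * ‖w - 1‖ := by
  have h1 : |‖w‖ - 1| ≤ ‖w - 1‖ := by simpa using abs_norm_sub_norm_le w 1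
  obtain ⟨h2, h3⟩ := abs_le.mp h1
  have h4 : 0 < ‖w‖ := by linarith
  rw [abs_le]
  constructor
  · have := Real.one_sub_inv_le_log_of_pos h4
    have h5 : ‖w‖⁻¹ ≤ 1 + 2 * ‖w - 1‖ := by
      rw [inv_le_iff_one_le_mul₀ h4]
      nlinarith
    linarith
  · have := Real.log_le_sub_one_of_pos h4
    linarith [norm_nonneg (w - 1)]

namespace IsMeromorphicModularForm

variable {f : ℍ → ℂ}

/-- Near q = 0, f agrees off 0 with an analytic G with G(0) = 1, so f has no zeros or poles there
and log|f| = O(|q|). -/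
lemma exists_bound_at_cusp (hf : IsMeromorphicModularForm 0 f)
    (hf_inf : Tendsto f atImInfty (𝓝 1)) :
    ∃ C Y : ℝ, 0 ≤ C ∧ ∀ τ : ℍ, Y ≤ τ.im →
      ordAt f τ = 0 ∧ |Real.log ‖f τ‖| ≤ C * Real.exp (-2 * Real.pi * τ.im) := by
  obtain ⟨G, hG, hG0, hfG⟩ := (meromorphicOrderAt_ne_top_iff hf.meromorphicAt_cusp).mp
    (hf.meromorphicOrderAt_cuspFunction_ne_top hf_inf (by simp))
  rw [hf.meromorphicOrderAt_cuspFunction_zero hf_inf] at hfG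
  have hfG' : cuspFunction 1 f =ᶠ[𝓝[≠] 0] G := by
    filter_upwards [hfG] with q hq
    simpa using hq
  have hG1 : G 0 = 1 := tendsto_nhds_unique
    (hG.continuousAt.tendsto.mono_left nhdsWithin_le_nhds)
    ((tendsto_cuspFunction hf_inf).congr' hfG')
  obtain ⟨C, hC⟩ := (hG.differentiableAt.isBigO_sub).bound
  have hsmall : ∀ᶠ q in 𝓝 (0 : ℂ), ‖G q - 1‖ < 1 / 2 := by
    have := hG.continuousAt.tendsto
    rw [hG1] at this
    simpa [dist_eq_norm] using Metric.tendsto_nhds.mp this (1 / 2) (by norm_num)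
  have hall : ∀ᶠ q in 𝓝 (0 : ℂ), ‖G q - 1‖ ≤ C * ‖q‖ ∧ ‖G q - 1‖ < 1 / 2 ∧ AnalyticAt ℂ G q ∧
      (q ≠ 0 → cuspFunction 1 f q = G q) ∧ G q ≠ 0 := by
    have h1 := eventually_nhdsWithin_iff.mp hfG'
    filter_upwards [hC, hsmall, hG.eventually_analyticAt, h1, hG.continuousAt.eventually_ne hG0]
      with q a1 a2 a3 a4 a5
    refine ⟨by simpa [hG1] using a1, a2, a3, a4, a5⟩
  obtain ⟨ε, hε, hball⟩ := Metric.eventually_nhds_iff_ball.mp hall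
  have hlim : Tendsto (fun v : ℝ => Real.exp (-2 * Real.pi * v)) atTop (𝓝 0) := by
    refine Real.tendsto_exp_atBot.comp ?_
    exact tendsto_id.const_mul_atTop_of_neg (by linarith [Real.pi_pos])
  obtain ⟨Y, hY⟩ := eventually_atTop.mp (hlim.eventually (gt_mem_nhds hε))
  -- The 2 comes from `abs_log_norm_le`.
  refine ⟨2 * |C|, Y, by positivity, fun τ hτ => ?_⟩
  set q := Function.Periodic.qParam 1 (τ : ℂ) with hq
  have hqn : ‖q‖ = Real.exp (-2 * Real.pi * τ.im) := by
    rw [hq, Function.Periodic.norm_qParam, div_one]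
    rfl
  have hq0 : q ≠ 0 := Function.Periodic.qParam_ne_zero _
  have hmem : q ∈ Metric.ball (0 : ℂ) ε := by
    rw [mem_ball_zero_iff, hqn]
    exact hY τ.im hτ
  obtain ⟨b1, b2, b3, b4, b5⟩ := hball q hmem
  constructor
  · have hev : cuspFunction 1 f =ᶠ[𝓝[≠] q] G := by
      refine eventually_nhdsWithin_of_eventually_nhds ?_
      filter_upwards [Metric.isOpen_ball.mem_nhds hmem, isOpen_ne.mem_nhds hq0] with w hw hw0
      exact (hball w hw).2.2.2.1 hw0
    rw [ordAt, ← hf.meromorphicOrderAt_cuspFunction, meromorphicOrderAt_congr hev,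
      b3.meromorphicOrderAt_eq, analyticOrderAt_eq_zero.mpr (Or.inr b5)]
    simp
  · rw [← hf.cuspFunction_qParam τ, b4 hq0, ← hqn]
    refine (abs_log_norm_le b2.le).trans ?_
    have : C * ‖q‖ ≤ |C| * ‖q‖ := by gcongr; exact le_abs_self C
    linarith

/-- Every such orbit meets the standard domain below the height Y, a compact set, and a divisor has
finite support there. -/
lemma finite_orbits_ordAt_ne_zero (hf : IsMeromorphicModularForm 0 f)
    (hf_inf : Tendsto f atImInfty (𝓝 1)) :
    {x : MulAction.orbitRel.Quotient SL(2, ℤ) ℍ | ordAt f x.out ≠ 0}.Finite := by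
  obtain ⟨C, Y, -, hY⟩ := hf.exists_bound_at_cusp hf_inf
  set K : Set ℍ := ModularGroup.truncatedFundamentalDomain Y
  have hK : IsCompact (((↑) : ℍ → ℂ) '' K) :=
    (ModularGroup.isCompact_truncatedFundamentalDomain Y).image continuous_coe
  have hm : MeromorphicOn (f ∘ ofComplex) (((↑) : ℍ → ℂ) '' K) := by
    rintro _ ⟨τ, -, rfl⟩
    exact hf.meromorphicOn τ τ.im_pos
  have hfin := (MeromorphicOn.divisor (f ∘ ofComplex) (((↑) : ℍ → ℂ) '' K)).finiteSupport hK
  refine ((hfin.preimage UpperHalfPlane.coe_injective.injOn).image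
    (fun τ : ℍ => (Quotient.mk _ τ : MulAction.orbitRel.Quotient SL(2, ℤ) ℍ))).subset ?_
  intro x hx
  obtain ⟨γ, hγ⟩ := ModularGroup.exists_smul_mem_fd x.out
  have hord : ordAt f (γ • x.out) ≠ 0 := by rw [hf.ordAt_smul]; exact hx
  have him : (γ • x.out).im ≤ Y := by
    by_contra! h
    exact hord (hY _ h.le).1
  have hmem : γ • x.out ∈ K := ⟨hγ, him⟩
  refine ⟨γ • x.out, ?_, ?_⟩
  · rw [Set.mem_preimage, Function.mem_support,
      MeromorphicOn.divisor_apply hm (Set.mem_image_of_mem _ hmem)]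
    exact hord
  · refine (Quotient.sound ?_).trans (Quotient.out_eq x)
    exact MulAction.orbitRel_apply.mpr ⟨γ, rfl⟩

/-- Below the height Y the pair sum is bounded and the logarithm locally integrable; above it,
exponential decay beats the growth v^k on a set of finite volume. -/
lemma integrableOn_fd_pairSum_mul (hf : IsMeromorphicModularForm 0 f)
    (hf_inf : Tendsto f atImInfty (𝓝 1)) {k : ℕ} (hk : 2 ≤ k) :
    IntegrableOn (fun τ => pairSum τ k * Real.log ‖f τ‖) ModularGroup.fd := by
  obtain ⟨C, Y, hC0, hY⟩ := hf.exists_bound_at_cusp hf_inf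
  obtain ⟨D, hD⟩ := pairSum_le_of_mem_fd hk
  have hloc := hf.locallyIntegrable_log_norm hf_inf
  have hmeas : AEStronglyMeasurable (fun τ => pairSum τ k * Real.log ‖f τ‖) :=
    (measurable_pairSum k).aestronglyMeasurable.mul hloc.aestronglyMeasurable
  have hsplit : ModularGroup.fd ⊆ ModularGroup.truncatedFundamentalDomain Y ∪
      (ModularGroup.fd ∩ {τ : ℍ | Y < τ.im}) := fun τ hτ => by
    rcases le_or_gt τ.im Y with h | h
    · exact Or.inl ⟨hτ, h⟩
    · exact Or.inr ⟨hτ, h⟩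
  have hYm : MeasurableSet {τ : ℍ | Y < τ.im} := (isOpen_lt continuous_const continuous_im).measurableSet
  have hfd : MeasurableSet ModularGroup.fd := ModularGroup.isClosed_fd.measurableSet
  refine IntegrableOn.mono_set (IntegrableOn.union ?_ ?_) hsplit
  · have hK := ModularGroup.isCompact_truncatedFundamentalDomain Y
    refine Integrable.bdd_mul (c := |D| * |Y| ^ k) (hloc.integrableOn_isCompact hK)
      (measurable_pairSum k).aestronglyMeasurable ?_
    filter_upwards [ae_restrict_mem hK.measurableSet] with τ hτ
    rw [Real.norm_of_nonneg (pairSum_nonneg τ k)]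
    refine (hD τ hτ.1).trans ?_
    have := τ.im_pos.le
    gcongr
    · exact le_abs_self D
    · exact hτ.2.trans (le_abs_self Y)
  · refine IntegrableOn.of_bound (C := |D| * (C * k.factorial))
      ((measure_mono Set.inter_subset_left).trans_lt volume_fd_lt_top) hmeas.restrict ?_
    filter_upwards [ae_restrict_mem (hfd.inter hYm)] with τ hτ
    rw [norm_mul, Real.norm_of_nonneg (pairSum_nonneg τ k), Real.norm_eq_abs]
    have h1 := hD τ hτ.1
    have h2 := (hY τ (le_of_lt hτ.2)).2
    have hv := τ.im_pos
    have h3 : τ.im ^ k * Real.exp (-2 * Real.pi * τ.im) ≤ k.factorial := by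
      have h4 := exp_neg_le_factorial_mul_rpow k hv
      have h5 : Real.exp (-2 * Real.pi * τ.im) ≤ Real.exp (-τ.im) := by
        rw [Real.exp_le_exp]
        nlinarith [Real.pi_gt_three]
      rw [Real.rpow_neg hv.le, Real.rpow_natCast] at h4
      calc _ ≤ τ.im ^ k * (k.factorial * (τ.im ^ k)⁻¹) := by
            gcongr
            exact h5.trans h4
        _ = k.factorial := by field_simp
    calc pairSum τ k * |Real.log ‖f τ‖|
        ≤ (|D| * τ.im ^ k) * (C * Real.exp (-2 * Real.pi * τ.im)) := by
          refine mul_le_mul (h1.trans ?_) h2 (abs_nonneg _) (by positivity)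
          gcongr
          exact le_abs_self D
      _ = |D| * (C * (τ.im ^ k * Real.exp (-2 * Real.pi * τ.im))) := by ring
      _ ≤ _ := by gcongr

end IsMeromorphicModularForm

/-- The pieces of F in the translates of the standard domain cover F, and moved back they make up
the integral over that domain. This transfers integrability to an arbitrary F, which may have
several cusps. -/
lemma setLIntegral_le_fd {F : Set ℍ} (hF : IsFundamentalDomain modularAut F volume)
    {φ : ℍ → ENNReal} (hφ : ∀ (p : modularAut) (τ : ℍ), φ (p • τ) = φ τ) :
    ∫⁻ τ in F, φ τ ≤ ∫⁻ τ in ModularGroup.fd, φ τ := by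
  rw [hF.setLIntegral_eq_tsum' φ ModularGroup.fd]
  simp_rw [hφ]
  refine le_trans (lintegral_mono_set ?_) (lintegral_iUnion_le _ _)
  intro τ hτ
  obtain ⟨γ, hγ⟩ := ModularGroup.exists_smul_mem_fd τ
  refine Set.mem_iUnion.mpr ⟨(toAut γ)⁻¹, ?_, hτ⟩
  rw [Set.mem_smul_set_iff_inv_smul_mem, inv_inv]
  exact hγ

lemma IsMeromorphicModularForm.integrableOn_pairSum_mul {f : ℍ → ℂ}
    (hf : IsMeromorphicModularForm 0 f)
    (hf_inf : Tendsto f atImInfty (𝓝 1)) {F : Set ℍ} (hF : IsFundamentalDomain modularAut F volume)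
    {k : ℕ} (hk : 2 ≤ k) :
    IntegrableOn (fun τ => pairSum τ k * Real.log ‖f τ‖) F := by
  have h := hf.integrableOn_fd_pairSum_mul hf_inf hk
  have hmeas : AEStronglyMeasurable (fun τ => pairSum τ k * Real.log ‖f τ‖) :=
    (measurable_pairSum k).aestronglyMeasurable.mul
      (hf.locallyIntegrable_log_norm hf_inf).aestronglyMeasurable
  refine ⟨hmeas.restrict, lt_of_le_of_lt (setLIntegral_le_fd hF fun p τ => ?_) h.2⟩
  beta_reduce
  rw [pairSum_smul p τ hk, hf.apply_aut_smul]

/-! ### The Eisenstein series is dominated by pair sums -/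

/-- By invariance τ may be taken in the standard domain, where the pair (0, 1) alone contributes (Im
τ)^k. This absorbs the additive constant in `norm_eisNum_le`. -/
lemma exists_pos_le_pairSum {k : ℕ} (hk : 2 ≤ k) : ∃ c : ℝ, 0 < c ∧ ∀ τ : ℍ, c ≤ pairSum τ k := by
  refine ⟨(1 / 2) ^ k, by positivity, fun τ => ?_⟩
  obtain ⟨γ, hγ⟩ := ModularGroup.exists_smul_mem_fd τ
  have h1 := ModularGroup.three_le_four_mul_im_sq_of_mem_fd hγ
  have h0 := (γ • τ).im_pos
  have h2 : 1 / 2 ≤ (γ • τ).im := by nlinarith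
  have h3 : pairSum (γ • τ) k = pairSum τ k := pairSum_smul (toAut γ) τ hk
  have h4 : pairForm (γ • τ) ![0, 1] ^ (-(k : ℝ)) = (γ • τ).im ^ k := by
    simp [pairForm]
  rw [← h3]
  calc (1 / 2 : ℝ) ^ k ≤ (γ • τ).im ^ k := by gcongr
    _ ≤ _ := by
      rw [← h4]
      exact (summable_pairForm_nat (γ • τ) hk).le_tsum ![0, 1]
        fun v _ => Real.rpow_nonneg (pairForm_nonneg _ v) _

lemma exists_norm_eisNum_le (R : ℝ) : ∃ (C : ℝ) (k : ℕ), 2 ≤ k ∧ 0 ≤ C ∧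
    ∀ (τ : ℍ) (s : ℂ), ‖s‖ ≤ R → ‖eisNum τ s‖ ≤ C * pairSum τ k := by
  obtain ⟨k, hk⟩ := exists_nat_ge (|R| + 2)
  have hk2 : 2 ≤ k := by
    have : (2 : ℝ) ≤ k := by linarith [abs_nonneg R]
    exact_mod_cast this
  obtain ⟨c, hc, hcp⟩ := exists_pos_le_pairSum hk2
  refine ⟨|(1 + 2 * |R|) * (|R| * (1 + |R|) * thetaConst k + 1)| * (c⁻¹ + 1), k, hk2,
    by positivity, fun τ s hs => ?_⟩
  refine (norm_eisNum_le hk τ (hs.trans (le_abs_self R))).trans ?_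
  rw [mul_assoc |_ * _|]
  have h1 : 1 ≤ c⁻¹ * pairSum τ k := by
    rw [inv_mul_eq_div, le_div_iff₀ hc, one_mul]
    exact hcp τ
  have := pairSum_nonneg τ k
  refine mul_le_mul (le_abs_self _) (by linarith) (by linarith) (abs_nonneg _)

/-! ### Jensen's formula on horizontal segments -/

lemma exists_mem_strip_qParam_eq {q : ℂ} (h0 : q ≠ 0) (h1 : ‖q‖ < 1) :
    ∃ τ ∈ strip, Function.Periodic.qParam 1 τ = q := by
  obtain ⟨τ, rfl⟩ := exists_qParam_eq h0 h1
  have him : 0 < ((τ : ℂ) + (-⌊τ.re⌋ : ℤ) * (1 : ℝ)).im := by simpa using τ.im_pos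
  refine ⟨⟨(τ : ℂ) + (-⌊τ.re⌋ : ℤ) * (1 : ℝ), him⟩, ?_, ?_⟩
  · change 0 ≤ ((τ : ℂ) + (-⌊τ.re⌋ : ℤ) * (1 : ℝ)).re ∧ ((τ : ℂ) + (-⌊τ.re⌋ : ℤ) * (1 : ℝ)).re < 1
    have h2 : ((τ : ℂ) + (-⌊τ.re⌋ : ℤ) * (1 : ℝ)).re = Int.fract τ.re := by
      simp [Int.fract, sub_eq_add_neg]
    rw [h2]
    exact ⟨Int.fract_nonneg _, Int.fract_lt_one _⟩
  · have h2 := Complex.exp_periodic.int_mul (-⌊τ.re⌋) (2 * Real.pi * Complex.I * τ / (1 : ℝ))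
    rw [Function.Periodic.qParam, Function.Periodic.qParam, ← h2]
    congr 1
    push_cast
    ring

lemma injOn_qParam_strip : Set.InjOn (fun τ : ℍ => Function.Periodic.qParam 1 (τ : ℂ)) strip := by
  intro τ hτ τ' hτ' h
  obtain ⟨m, hm⟩ := (Function.Periodic.qParam_left_inv_mod_period (h := 1) one_ne_zero (τ : ℂ))
  obtain ⟨m', hm'⟩ := (Function.Periodic.qParam_left_inv_mod_period (h := 1) one_ne_zero (τ' : ℂ))
  beta_reduce at h
  rw [h, hm'] at hm
  have hre : τ'.re + m' = τ.re + m := by simpa using congrArg Complex.re hm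
  have him : τ'.im = τ.im := by simpa using congrArg Complex.im hm
  have hmm : m' = m := by
    have h1 : (m' : ℝ) - m < 1 := by linarith [hτ.2, hτ'.1]
    have h2 : (m : ℝ) - m' < 1 := by linarith [hτ.1, hτ'.2]
    have h3 : m' - m < 1 := by exact_mod_cast h1
    have h4 : m - m' < 1 := by exact_mod_cast h2
    omega
  subst hmm
  exact UpperHalfPlane.ext_re_im (by linarith) him.symm

/-- The points of the strip at which `f` has a zero or a pole. -/
abbrev StripDivisor (f : ℍ → ℂ) : Type := {z : ℍ // z ∈ strip ∧ ordAt f z ≠ 0}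

namespace IsMeromorphicModularForm

variable {f : ℍ → ℂ}

/-- Jensen's formula: a zero or pole at q(z) inside the circle contributes log(R / |q(z)|) = 2π(Im z
- v). The terms from the centre vanish because the order there is 0 and the leading coefficient 1.
-/
lemma circleAverage_log_norm_cuspFunction (hf : IsMeromorphicModularForm 0 f)
    (hf_inf : Tendsto f atImInfty (𝓝 1)) {v : ℝ} (hv : 0 < v) :
    Real.circleAverage (fun q => Real.log ‖cuspFunction 1 f q‖) 0 (Real.exp (-2 * Real.pi * v)) =
      ∑' z : StripDivisor f, (ordAt f z : ℝ) * (2 * Real.pi * max (z.1.im - v) 0) := by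
  set R := Real.exp (-2 * Real.pi * v) with hR
  have hR0 : 0 < R := Real.exp_pos _
  have hR1 : R < 1 := by
    rw [hR, Real.exp_lt_one_iff]
    nlinarith [Real.pi_pos]
  have hsub : Metric.closedBall (0 : ℂ) |R| ⊆ Metric.ball 0 1 :=
    Metric.closedBall_subset_ball (by rwa [abs_of_pos hR0])
  have hm : MeromorphicOn (cuspFunction 1 f) (Metric.closedBall 0 |R|) := fun q hq =>
    hf.meromorphicOn_cuspFunction q (hsub hq)
  rw [MeromorphicOn.circleAverage_log_norm hR0.ne' hm,
    hf.meromorphicTrailingCoeffAt_cuspFunction hf_inf,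
    MeromorphicOn.divisor_apply hm (Metric.mem_closedBall_self (abs_nonneg R)),
    hf.meromorphicOrderAt_cuspFunction_zero hf_inf]
  simp only [WithTop.untop₀_zero, Int.cast_zero, zero_mul, norm_one, Real.log_one, add_zero,
    zero_sub, norm_neg]
  set D := MeromorphicOn.divisor (cuspFunction 1 f) (Metric.closedBall 0 |R|) with hD
  have hfin : (Function.support fun u => (D u : ℝ) * Real.log (R * ‖u‖⁻¹)).Finite := by
    refine (D.finiteSupport (isCompact_closedBall _ _)).subset fun u hu => ?_
    rw [Function.mem_support] at hu ⊢
    intro h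
    exact hu (by rw [h, Int.cast_zero, zero_mul])
  have hinj : Function.Injective
      fun z : StripDivisor f => Function.Periodic.qParam 1 ((z : ℍ) : ℂ) := fun z z' h =>
    Subtype.ext (injOn_qParam_strip z.2.1 z'.2.1 h)
  have hlog : ∀ z : ℍ, ‖Function.Periodic.qParam 1 (z : ℂ)‖ = Real.exp (-2 * Real.pi * z.im) := by
    intro z
    rw [Function.Periodic.norm_qParam, div_one]
    rfl
  rw [← tsum_eq_finsum (L := .unconditional ℂ) hfin, ← hinj.tsum_eq]
  · refine tsum_congr fun z => ?_
    rcases le_or_gt v z.1.im with h | h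
    · have hmem : Function.Periodic.qParam 1 ((z : ℍ) : ℂ) ∈ Metric.closedBall (0 : ℂ) |R| := by
        rw [mem_closedBall_zero_iff, hlog, abs_of_pos hR0, hR, Real.exp_le_exp]
        nlinarith [Real.pi_pos]
      rw [hD, MeromorphicOn.divisor_apply hm hmem, hf.meromorphicOrderAt_cuspFunction, hlog,
        ← Real.exp_neg, hR, ← Real.exp_add, Real.log_exp, max_eq_left (by linarith)]
      rw [ordAt]
      ring
    · have hmem : Function.Periodic.qParam 1 ((z : ℍ) : ℂ) ∉ Metric.closedBall (0 : ℂ) |R| := by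
        rw [mem_closedBall_zero_iff, hlog, abs_of_pos hR0, hR, Real.exp_le_exp]
        nlinarith [Real.pi_pos]
      rw [max_eq_right (by linarith), D.apply_eq_zero_of_notMem hmem]
      simp
  · intro u hu
    rw [Function.mem_support] at hu
    have hDu : D u ≠ 0 := fun h => hu (by rw [h, Int.cast_zero, zero_mul])
    have hmem : u ∈ Metric.closedBall (0 : ℂ) |R| := by
      by_contra h
      exact hDu (D.apply_eq_zero_of_notMem h)
    -- The centre has no preimage in the strip, but its term is zero since 0⁻¹ = 0 and log 0 = 0.
    have hu0 : u ≠ 0 := fun h => hu (by simp [h])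
    obtain ⟨z, hz, rfl⟩ := exists_mem_strip_qParam_eq hu0 (mem_ball_zero_iff.mp (hsub hmem))
    refine ⟨⟨z, hz, ?_⟩, rfl⟩
    rw [hD, MeromorphicOn.divisor_apply hm hmem, hf.meromorphicOrderAt_cuspFunction] at hDu
    exact hDu

lemma integral_log_norm_eq_circleAverage (hf : IsMeromorphicModularForm 0 f) {v : ℝ} (hv : 0 < v) :
    ∫ u in Set.Ico (0 : ℝ) 1, Real.log ‖f (ofCoords u v)‖ =
      Real.circleAverage (fun q => Real.log ‖cuspFunction 1 f q‖) 0
        (Real.exp (-2 * Real.pi * v)) := by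
  rw [Real.circleAverage_def, integral_Ico_eq_integral_Ioc,
    ← intervalIntegral.integral_of_le zero_le_one]
  have h := intervalIntegral.integral_comp_mul_left (a := 0) (b := 1) (fun θ => Real.log
    ‖cuspFunction 1 f (circleMap 0 (Real.exp (-2 * Real.pi * v)) θ)‖)
    (c := 2 * Real.pi) (by positivity)
  rw [mul_zero, mul_one] at h
  rw [← h]
  refine intervalIntegral.integral_congr fun u _ => ?_
  rw [← hf.cuspFunction_qParam, coe_ofCoords hv]
  congr 3
  rw [circleMap, Function.Periodic.qParam, zero_add, Complex.ofReal_exp, ← Complex.exp_add]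
  congr 1
  push_cast
  ring_nf
  rw [Complex.I_sq]
  ring

lemma integral_log_norm (hf : IsMeromorphicModularForm 0 f)
    (hf_inf : Tendsto f atImInfty (𝓝 1)) {v : ℝ} (hv : 0 < v) :
    ∫ u in Set.Ico (0 : ℝ) 1, Real.log ‖f (ofCoords u v)‖ =
      ∑' z : StripDivisor f, (ordAt f z : ℝ) * (2 * Real.pi * max (z.1.im - v) 0) := by
  rw [hf.integral_log_norm_eq_circleAverage hv, hf.circleAverage_log_norm_cuspFunction hf_inf hv]

end IsMeromorphicModularForm

/-! ### The Mellin transform of `max (y - v) 0` -/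

lemma cpow_mul_max_eq_indicator {s : ℂ} {y : ℝ} :
    Set.EqOn (fun v : ℝ => (v : ℂ) ^ (s - 2) * (max (y - v) 0 : ℝ))
      ((Set.Ioc 0 y).indicator fun v : ℝ => y * (v : ℂ) ^ (s - 2) - (v : ℂ) ^ (s - 1))
      (Set.Ioi 0) := by
  intro v hv
  have hv' : (v : ℂ) ≠ 0 := Complex.ofReal_ne_zero.mpr (ne_of_gt hv)
  by_cases h : v ≤ y
  · rw [Set.indicator_of_mem (show v ∈ Set.Ioc 0 y from ⟨hv, h⟩)]
    beta_reduce
    rw [max_eq_left (by linarith), show s - 1 = s - 2 + 1 by ring, Complex.cpow_add _ _ hv',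
      Complex.cpow_one]
    push_cast
    ring
  · rw [Set.indicator_of_notMem fun h' : v ∈ Set.Ioc 0 y => h h'.2]
    beta_reduce
    rw [max_eq_right (by linarith)]
    simp

lemma integrableOn_cpow_mul_max {s : ℂ} (hs : 1 < s.re) {y : ℝ} (hy : 0 < y) :
    IntegrableOn (fun v : ℝ => (v : ℂ) ^ (s - 2) * (max (y - v) 0 : ℝ)) (Set.Ioi 0) := by
  rw [integrableOn_congr_fun cpow_mul_max_eq_indicator measurableSet_Ioi]
  refine (IntegrableOn.integrable_indicator ?_ measurableSet_Ioc).integrableOn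
  rw [← intervalIntegrable_iff_integrableOn_Ioc_of_le hy.le]
  exact ((intervalIntegral.intervalIntegrable_cpow' (by simp; linarith)).const_mul _).sub
    (intervalIntegral.intervalIntegrable_cpow' (by simp; linarith))

lemma integral_cpow_mul_max {s : ℂ} (hs : 1 < s.re) {y : ℝ} (hy : 0 < y) :
    ∫ v in Set.Ioi (0 : ℝ), (v : ℂ) ^ (s - 2) * (max (y - v) 0 : ℝ) =
      (y : ℂ) ^ s / (s * (s - 1)) := by
  have hs0 : s ≠ 0 := fun h => by simp [h] at hs; linarith
  have hs1 : s - 1 ≠ 0 := fun h => by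
    rw [sub_eq_zero] at h
    simp [h] at hs
  have hy' : (y : ℂ) ≠ 0 := Complex.ofReal_ne_zero.mpr hy.ne'
  rw [setIntegral_congr_fun measurableSet_Ioi cpow_mul_max_eq_indicator,
    setIntegral_indicator measurableSet_Ioc,
    Set.inter_eq_right.mpr fun v hv => hv.1, ← intervalIntegral.integral_of_le hy.le,
    intervalIntegral.integral_sub
      ((intervalIntegral.intervalIntegrable_cpow' (by simp; linarith)).const_mul _)
      (intervalIntegral.intervalIntegrable_cpow' (by simp; linarith)),
    intervalIntegral.integral_const_mul, integral_cpow (Or.inl (by simp; linarith)),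
    integral_cpow (Or.inl (by simp; linarith)), show s - 2 + 1 = s - 1 by ring, sub_add_cancel,
    Complex.ofReal_zero, Complex.zero_cpow hs0, Complex.zero_cpow hs1, sub_zero, sub_zero]
  have : (y : ℂ) ^ s = y * (y : ℂ) ^ (s - 1) := by
    conv_lhs => rw [show s = 1 + (s - 1) by ring, Complex.cpow_add _ _ hy', Complex.cpow_one]
  rw [this]
  field_simp
  ring

/-! ### Unfolding -/

lemma measurableSet_strip : MeasurableSet strip :=
  (measurableSet_le measurable_const continuous_re.measurable).inter
    (measurableSet_lt continuous_re.measurable measurable_const)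

/-- The function whose sum over an orbit is the Eisenstein series. -/
def stripPow (s : ℂ) : ℍ → ℂ := strip.indicator fun z => (z.im : ℂ) ^ s

lemma measurable_stripPow (s : ℂ) : Measurable (stripPow s) :=
  ((Complex.measurable_ofReal.comp continuous_im.measurable).pow_const s).indicator measurableSet_strip

lemma ofReal_norm_stripPow (s : ℂ) (z : ℍ) : ((‖stripPow s z‖ : ℝ) : ℂ) = stripPow s.re z := by
  by_cases hz : z ∈ strip
  · rw [stripPow, stripPow, Set.indicator_of_mem hz, Set.indicator_of_mem hz,
      Complex.norm_cpow_eq_rpow_re_of_pos z.im_pos, Complex.ofReal_cpow z.im_pos.le]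
  · rw [stripPow, stripPow, Set.indicator_of_notMem hz, Set.indicator_of_notMem hz, norm_zero,
      Complex.ofReal_zero]

lemma hasSum_stripPow (τ : ℍ) {s : ℂ} (hs : 1 < s.re) :
    HasSum (fun p : modularAut => stripPow s (p • τ)) (eisenstein τ s) :=
  hasSum_strip τ hs

/-- As |y^s| = y^(Re s), absolute convergence at s is the Eisenstein series at Re s. -/
lemma hasSum_norm_stripPow (τ : ℍ) {s : ℂ} (hs : 1 < s.re) :
    HasSum (fun p : modularAut => ‖stripPow s (p • τ)‖) ‖eisenstein τ s.re‖ := by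
  have h := hasSum_stripPow τ (s := s.re) (by simpa using hs)
  simp_rw [← ofReal_norm_stripPow] at h
  have h2 : HasSum (fun p : modularAut => ‖stripPow s (p • τ)‖) (∑' p : modularAut, ‖stripPow s (p • τ)‖) :=
    (Complex.summable_ofReal.mp h.summable).hasSum
  rw [← h.tsum_eq, ← Complex.ofReal_tsum, Complex.norm_real, Real.norm_of_nonneg (tsum_nonneg fun _ => norm_nonneg _)]
  exact h2

lemma exists_norm_eisenstein_le {s : ℂ} (hs : eisDen s ≠ 0) : ∃ (C : ℝ) (k : ℕ), 2 ≤ k ∧ 0 ≤ C ∧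
    ∀ τ : ℍ, ‖eisenstein τ s‖ ≤ C * pairSum τ k := by
  obtain ⟨C, k, hk, hC, h⟩ := exists_norm_eisNum_le ‖s‖
  refine ⟨C / ‖eisDen s‖, k, hk, by positivity, fun τ => ?_⟩
  rw [eisenstein_eq_div τ hs, norm_div, div_mul_eq_mul_div]
  gcongr
  exact h τ s le_rfl

lemma stronglyMeasurable_eisenstein {s : ℂ} (hs : eisDen s ≠ 0) :
    StronglyMeasurable fun τ => eisenstein τ s := by
  simp_rw [eisenstein_eq_div _ hs, div_eq_mul_inv]
  exact (stronglyMeasurable_eisNum s).mul_const _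

namespace IsMeromorphicModularForm

variable {f : ℍ → ℂ} {F : Set ℍ}

lemma aestronglyMeasurable_log_norm (hf : IsMeromorphicModularForm 0 f)
    (hf_inf : Tendsto f atImInfty (𝓝 1)) :
    AEStronglyMeasurable fun τ => ((Real.log ‖f τ‖ : ℝ) : ℂ) :=
  Complex.continuous_ofReal.comp_aestronglyMeasurable
    (hf.locallyIntegrable_log_norm hf_inf).aestronglyMeasurable

lemma aestronglyMeasurable_stripPow_smul_mul (hf : IsMeromorphicModularForm 0 f)
    (hf_inf : Tendsto f atImInfty (𝓝 1)) (s : ℂ) (p : modularAut) :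
    AEStronglyMeasurable fun τ => stripPow s (p • τ) * ((Real.log ‖f τ‖ : ℝ) : ℂ) :=
  ((measurable_stripPow s).comp (measurable_const_smul p)).aestronglyMeasurable.mul
    (hf.aestronglyMeasurable_log_norm hf_inf)

lemma integrableOn_mul_log_norm (hf : IsMeromorphicModularForm 0 f)
    (hf_inf : Tendsto f atImInfty (𝓝 1)) (hF : IsFundamentalDomain modularAut F volume)
    {φ : ℍ → ℂ} (hφ : AEStronglyMeasurable φ) {C : ℝ} {k : ℕ} (hk : 2 ≤ k)
    (hC : ∀ τ, ‖φ τ‖ ≤ C * pairSum τ k) :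
    IntegrableOn (fun τ => φ τ * (Real.log ‖f τ‖ : ℝ)) F := by
  refine Integrable.mono' ((hf.integrableOn_pairSum_mul hf_inf hF hk).norm.const_mul C)
    (hφ.mul (hf.aestronglyMeasurable_log_norm hf_inf)).restrict (ae_of_all _ fun τ => ?_)
  rw [norm_mul, norm_mul, Complex.norm_real, Real.norm_of_nonneg (pairSum_nonneg τ k), ← mul_assoc]
  gcongr
  exact hC τ

lemma integrableOn_eisenstein_mul (hf : IsMeromorphicModularForm 0 f)
    (hf_inf : Tendsto f atImInfty (𝓝 1)) (hF : IsFundamentalDomain modularAut F volume)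
    {s : ℂ} (hs : eisDen s ≠ 0) :
    IntegrableOn (fun τ => eisenstein τ s * (Real.log ‖f τ‖ : ℝ)) F := by
  obtain ⟨C, k, hk, -, h⟩ := exists_norm_eisenstein_le hs
  exact hf.integrableOn_mul_log_norm hf_inf hF
    (stronglyMeasurable_eisenstein hs).aestronglyMeasurable hk h

/-- By Tonelli the sum is the integral of |E(τ, Re s) log|f|| over F, already known to be finite. It
justifies both unfolding and the exchange of sum and integral. -/
lemma tsum_lintegral_stripPow (hf : IsMeromorphicModularForm 0 f)
    (hf_inf : Tendsto f atImInfty (𝓝 1)) (hF : IsFundamentalDomain modularAut F volume)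
    {s : ℂ} (hs : 1 < s.re) :
    ∑' p : modularAut, ∫⁻ τ in F, ‖stripPow s (p • τ) * (Real.log ‖f τ‖ : ℝ)‖ₑ ≠ ⊤ := by
  rw [← lintegral_tsum fun p =>
    (hf.aestronglyMeasurable_stripPow_smul_mul hf_inf s p).restrict.enorm]
  have h := hf.integrableOn_eisenstein_mul hf_inf hF
    (eisDen_ne_zero (s := s.re) (by simpa using hs))
  refine ne_of_lt (lt_of_le_of_lt (le_of_eq ?_) h.2)
  refine lintegral_congr fun τ => ?_
  simp_rw [enorm_mul]
  rw [ENNReal.tsum_mul_right]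
  congr 1
  have h2 := hasSum_norm_stripPow τ hs
  simp_rw [← ofReal_norm]
  rw [← ENNReal.ofReal_tsum_of_nonneg (fun _ => norm_nonneg _) h2.summable, h2.tsum_eq]

lemma integrable_stripPow_mul (hf : IsMeromorphicModularForm 0 f)
    (hf_inf : Tendsto f atImInfty (𝓝 1)) (hF : IsFundamentalDomain modularAut F volume)
    {s : ℂ} (hs : 1 < s.re) :
    Integrable fun τ => stripPow s τ * (Real.log ‖f τ‖ : ℝ) := by
  refine ⟨(measurable_stripPow s).aestronglyMeasurable.mul
    (hf.aestronglyMeasurable_log_norm hf_inf), ?_⟩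
  rw [HasFiniteIntegral, hF.lintegral_eq_tsum'']
  simp_rw [hf.apply_aut_smul]
  exact (hf.tsum_lintegral_stripPow hf_inf hF hs).lt_top

lemma integral_eisenstein_mul (hf : IsMeromorphicModularForm 0 f)
    (hf_inf : Tendsto f atImInfty (𝓝 1)) (hF : IsFundamentalDomain modularAut F volume)
    {s : ℂ} (hs : 1 < s.re) :
    ∫ τ in F, eisenstein τ s * (Real.log ‖f τ‖ : ℝ) =
      ∫ τ, stripPow s τ * (Real.log ‖f τ‖ : ℝ) := by
  rw [hF.integral_eq_tsum'' _ (hf.integrable_stripPow_mul hf_inf hF hs)]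
  simp_rw [hf.apply_aut_smul]
  rw [← integral_tsum (fun p =>
    (hf.aestronglyMeasurable_stripPow_smul_mul hf_inf s p).restrict)
    (hf.tsum_lintegral_stripPow hf_inf hF hs)]
  refine integral_congr_ae (ae_of_all _ fun τ => ?_)
  beta_reduce
  rw [tsum_mul_right, (hasSum_stripPow τ hs).tsum_eq]

lemma integral_stripPow_mul (hf : IsMeromorphicModularForm 0 f)
    (hf_inf : Tendsto f atImInfty (𝓝 1)) (hF : IsFundamentalDomain modularAut F volume)
    {s : ℂ} (hs : 1 < s.re) :
    ∫ τ, stripPow s τ * (Real.log ‖f τ‖ : ℝ) = ∫ v in Set.Ioi (0 : ℝ), (v : ℂ) ^ (s - 2) *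
      (∑' z : StripDivisor f, (ordAt f z : ℝ) * (2 * Real.pi * max (z.1.im - v) 0) : ℝ) := by
  have hrect : strip = rect (Set.Ico 0 1) (Set.Ioi 0) := by
    ext τ
    exact ⟨fun h => ⟨h, τ.im_pos⟩, fun h => h.1⟩
  have hint := (hf.integrable_stripPow_mul hf_inf hF hs).integrableOn (s := strip)
  have h1 : ∫ τ, stripPow s τ * (Real.log ‖f τ‖ : ℝ) =
      ∫ τ in strip, stripPow s τ * (Real.log ‖f τ‖ : ℝ) := by
    refine (setIntegral_eq_integral_of_forall_compl_eq_zero fun τ hτ => ?_).symm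
    rw [stripPow, Set.indicator_of_notMem hτ, zero_mul]
  rw [h1]
  have hmem : ∀ u ∈ Set.Ico (0 : ℝ) 1, ∀ v ∈ Set.Ioi (0 : ℝ), ofCoords u v ∈ strip := by
    intro u hu v hv
    rw [strip, Set.mem_ofPred_eq, re_ofCoords hv]
    exact hu
  rw [hrect] at hint
  rw [show ∫ τ in strip, stripPow s τ * (Real.log ‖f τ‖ : ℝ) =
    ∫ τ in rect (Set.Ico 0 1) (Set.Ioi 0), stripPow s τ * (Real.log ‖f τ‖ : ℝ) by rw [← hrect],
    setIntegral_rect measurableSet_Ico measurableSet_Ioi subset_rfl hint]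
  refine setIntegral_congr_fun measurableSet_Ioi fun v hv => ?_
  have hv' : (v : ℂ) ≠ 0 := Complex.ofReal_ne_zero.mpr (ne_of_gt hv)
  have hcongr : Set.EqOn (fun u : ℝ => ((v ^ 2)⁻¹ : ℝ) •
      (stripPow s (ofCoords u v) * (Real.log ‖f (ofCoords u v)‖ : ℝ)))
      (fun u => (v : ℂ) ^ (s - 2) * (Real.log ‖f (ofCoords u v)‖ : ℝ)) (Set.Ico 0 1) := by
    intro u hu
    beta_reduce
    rw [stripPow, Set.indicator_of_mem (hmem u hu v hv), im_ofCoords hv, Complex.real_smul,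
      Complex.cpow_sub _ _ hv', Complex.cpow_ofNat, ← mul_assoc]
    push_cast
    ring
  rw [setIntegral_congr_fun measurableSet_Ico hcongr, integral_const_mul, integral_complex_ofReal,
    hf.integral_log_norm hf_inf hv]

end IsMeromorphicModularForm

/-! ### Sums over the strip and sums over orbits -/

/-- The orbit map to the fibre of the quotient map over `x`. -/
def orbitMap (x : MulAction.orbitRel.Quotient SL(2, ℤ) ℍ) (p : modularAut) :
    {τ : ℍ // (Quotient.mk _ τ : MulAction.orbitRel.Quotient SL(2, ℤ) ℍ) = x} :=
  ⟨p • x.out, by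
    obtain ⟨γ, rfl⟩ := toAut_surjective p
    exact (Quotient.sound (MulAction.orbitRel_apply.mpr ⟨γ, rfl⟩)).trans (Quotient.out_eq x)⟩

lemma orbitMap_surjective (x : MulAction.orbitRel.Quotient SL(2, ℤ) ℍ) :
    Function.Surjective (orbitMap x) := by
  rintro ⟨τ, hτ⟩
  obtain ⟨γ, hγ⟩ := MulAction.orbitRel_apply.mp (Quotient.exact (hτ.trans (Quotient.out_eq x).symm))
  exact ⟨toAut γ, Subtype.ext hγ⟩

lemma card_fiber_orbitMap (x : MulAction.orbitRel.Quotient SL(2, ℤ) ℍ)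
    (y : {τ : ℍ // (Quotient.mk _ τ : MulAction.orbitRel.Quotient SL(2, ℤ) ℍ) = x}) :
    Nat.card {p : modularAut // orbitMap x p = y} = omega x.out := by
  obtain ⟨p, rfl⟩ := orbitMap_surjective x y
  rw [omega_eq_card_stabilizer]
  refine Nat.card_congr ((Equiv.mulLeft p⁻¹).subtypeEquiv fun q => ?_)
  rw [Equiv.coe_mulLeft, MulAction.mem_stabilizer_iff, mul_smul, inv_smul_eq_iff]
  exact Subtype.ext_iff

/-- Orbit–stabilizer: the fibres of p ↦ px all have ω_x elements. Infinite fibres need no exclusion,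
since `Nat.card` and the sum of a nonzero constant both default to 0. -/
lemma tsum_smul_eq (x : MulAction.orbitRel.Quotient SL(2, ℤ) ℍ) {E : Type*} [NormedAddCommGroup E]
    [CompleteSpace E] {g : ℍ → E} (hg : Summable fun p : modularAut => g (p • x.out)) :
    (Summable fun y : {τ : ℍ // (Quotient.mk _ τ : MulAction.orbitRel.Quotient SL(2, ℤ) ℍ) = x} =>
      g y) ∧
    ∑' p : modularAut, g (p • x.out) = omega x.out •
      ∑' y : {τ : ℍ // (Quotient.mk _ τ : MulAction.orbitRel.Quotient SL(2, ℤ) ℍ) = x}, g y := by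
  have h1 : Summable fun y : {τ : ℍ //
      (Quotient.mk _ τ : MulAction.orbitRel.Quotient SL(2, ℤ) ℍ) = x} => g y := by
    have hinj := Function.injective_surjInv (orbitMap_surjective x)
    refine (hg.comp_injective hinj).congr fun y => ?_
    exact congrArg (fun z => g (Subtype.val z)) (Function.surjInv_eq (orbitMap_surjective x) y)
  refine ⟨h1, ?_⟩
  have h2 : Summable ((fun p : modularAut => g (p • x.out)) ∘ Equiv.sigmaFiberEquiv (orbitMap x)) :=
    (Equiv.summable_iff _).mpr hg
  rw [← (Equiv.sigmaFiberEquiv (orbitMap x)).tsum_eq, ← h1.tsum_const_smul]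
  refine h2.tsum_sigma.trans (tsum_congr fun y => ?_)
  rw [← card_fiber_orbitMap x y, ← tsum_const]
  refine tsum_congr fun p => ?_
  exact congrArg (fun z => g (Subtype.val z)) p.2

/-- An infinite stabilizer would repeat one nonzero term infinitely often in the convergent series
for E(z, 2). -/
lemma omega_ne_zero (z : ℍ) : omega z ≠ 0 := by
  rw [omega_eq_card_stabilizer]
  rcases finite_or_infinite (MulAction.stabilizer modularAut z) with h | h
  · exact Nat.card_pos.ne'
  · set p := stripRep z (Quotient.mk _ 1)
    have hs := (hasSum_stripPow z (s := 2) (by simp)).summable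
    have hinj : Function.Injective fun q : MulAction.stabilizer modularAut z => p * (q : modularAut) :=
      fun q q' h => Subtype.ext (mul_left_cancel h)
    have h2 := hs.comp_injective hinj
    have h3 : ((fun p : modularAut => stripPow 2 (p • z)) ∘
        fun q : MulAction.stabilizer modularAut z => p * (q : modularAut)) =
        fun _ => stripPow 2 (p • z) := by
      funext q
      rw [Function.comp_apply, mul_smul, MulAction.mem_stabilizer_iff.mp q.2]
    rw [h3, summable_const_iff, stripPow, Set.indicator_of_mem (stripRep_smul_mem z _)] at h2
    exact absurd h2 (by simpa using (p • z).im_ne_zero)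

namespace IsMeromorphicModularForm

variable {f : ℍ → ℂ} {F : Set ℍ}

lemma tsum_fiber (hf : IsMeromorphicModularForm 0 f) {s : ℂ} (hs : 1 < s.re)
    (x : MulAction.orbitRel.Quotient SL(2, ℤ) ℍ) :
    (Summable fun y : {τ : ℍ // (Quotient.mk _ τ : MulAction.orbitRel.Quotient SL(2, ℤ) ℍ) = x} =>
      (ordAt f y : ℂ) * stripPow s y) ∧
    ∑' y : {τ : ℍ // (Quotient.mk _ τ : MulAction.orbitRel.Quotient SL(2, ℤ) ℍ) = x},
      (ordAt f y : ℂ) * stripPow s y =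
      (ordAt f x.out : ℂ) / (omega x.out : ℂ) * eisenstein x.out s := by
  have h : HasSum (fun p : modularAut => (ordAt f (p • x.out) : ℂ) * stripPow s (p • x.out))
      ((ordAt f x.out : ℂ) * eisenstein x.out s) := by
    simp_rw [hf.ordAt_aut_smul]
    exact (hasSum_stripPow x.out hs).mul_left _
  obtain ⟨h1, h2⟩ := tsum_smul_eq x (g := fun z => (ordAt f z : ℂ) * stripPow s z) h.summable
  refine ⟨h1, ?_⟩
  rw [h.tsum_eq, nsmul_eq_mul] at h2
  rw [div_mul_eq_mul_div, h2, mul_div_cancel_left₀]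
  exact Nat.cast_ne_zero.mpr (omega_ne_zero _)

lemma summable_ordAt_mul_stripPow (hf : IsMeromorphicModularForm 0 f)
    (hf_inf : Tendsto f atImInfty (𝓝 1)) {s : ℂ} (hs : 1 < s.re) :
    Summable fun z : ℍ => (ordAt f z : ℂ) * stripPow s z := by
  refine Summable.of_norm ?_
  rw [← (Equiv.sigmaFiberEquiv
    (Quotient.mk _ : ℍ → MulAction.orbitRel.Quotient SL(2, ℤ) ℍ)).summable_iff]
  refine (summable_sigma_of_nonneg fun _ => norm_nonneg _).mpr ⟨fun x => (hf.tsum_fiber hs x).1.norm, ?_⟩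
  refine summable_of_hasFiniteSupport ((hf.finite_orbits_ordAt_ne_zero hf_inf).subset fun x hx => ?_)
  rw [Function.mem_support] at hx
  intro h0
  refine hx ?_
  refine (tsum_congr fun y => ?_).trans tsum_zero
  obtain ⟨p, rfl⟩ := orbitMap_surjective x y
  have h1 : ordAt f (orbitMap x p).1 = 0 := (hf.ordAt_aut_smul p x.out).trans h0
  change ‖(ordAt f (orbitMap x p).1 : ℂ) * _‖ = 0
  rw [h1, Int.cast_zero, zero_mul, norm_zero]

lemma tsum_ordAt_mul_stripPow (hf : IsMeromorphicModularForm 0 f)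
    (hf_inf : Tendsto f atImInfty (𝓝 1)) {s : ℂ} (hs : 1 < s.re) :
    ∑' z : ℍ, (ordAt f z : ℂ) * stripPow s z =
      ∑ᶠ x : MulAction.orbitRel.Quotient SL(2, ℤ) ℍ,
        (ordAt f x.out : ℂ) / (omega x.out : ℂ) * eisenstein x.out s := by
  have h := (Equiv.sigmaFiberEquiv
    (Quotient.mk _ : ℍ → MulAction.orbitRel.Quotient SL(2, ℤ) ℍ)).summable_iff.mpr
    (hf.summable_ordAt_mul_stripPow hf_inf hs)
  rw [← (Equiv.sigmaFiberEquiv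
    (Quotient.mk _ : ℍ → MulAction.orbitRel.Quotient SL(2, ℤ) ℍ)).tsum_eq, ← tsum_eq_finsum (L := .unconditional _)]
  · refine h.tsum_sigma.trans (tsum_congr fun x => ?_)
    exact (hf.tsum_fiber hs x).2
  · refine (hf.finite_orbits_ordAt_ne_zero hf_inf).subset fun x hx h0 => hx ?_
    beta_reduce
    rw [h0, Int.cast_zero, zero_div, zero_mul]

lemma injective_stripDivisor_val : Function.Injective (Subtype.val : StripDivisor f → ℍ) :=
  Subtype.val_injective

lemma support_ordAt_mul_stripPow (s : ℂ) :
    Function.support (fun z : ℍ => (ordAt f z : ℂ) * stripPow s z) ⊆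
      Set.range (Subtype.val : StripDivisor f → ℍ) := by
  intro z hz
  rw [Function.mem_support] at hz
  refine ⟨⟨z, ?_, fun h => hz (by rw [h, Int.cast_zero, zero_mul])⟩, rfl⟩
  by_contra h
  exact hz (by rw [stripPow, Set.indicator_of_notMem h, mul_zero])

lemma countable_ordAt_ne_zero (hf : IsMeromorphicModularForm 0 f)
    (hf_inf : Tendsto f atImInfty (𝓝 1)) : {z : ℍ | ordAt f z ≠ 0}.Countable := by
  have h := (hf.finite_orbits_ordAt_ne_zero hf_inf).countable.biUnion
    (t := fun x _ => Set.range fun p : modularAut => p • x.out)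
    fun x _ => Set.countable_range _
  refine h.mono fun z hz => ?_
  obtain ⟨p, hp⟩ := orbitMap_surjective (Quotient.mk _ z) ⟨z, rfl⟩
  have hp' := congrArg Subtype.val hp
  refine Set.mem_biUnion (x := Quotient.mk _ z) ?_ ⟨p, hp'⟩
  rw [Set.mem_ofPred_eq, ← hf.ordAt_aut_smul p]
  exact fun h0 => hz ((congrArg (ordAt f) hp').symm.trans h0)

/-- Mellin transform term by term. The integrals of the norms are, up to a constant, the norms of
the terms of the resulting sum, which converges absolutely. -/
lemma integral_tsum_stripDivisor (hf : IsMeromorphicModularForm 0 f)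
    (hf_inf : Tendsto f atImInfty (𝓝 1)) {s : ℂ} (hs : 1 < s.re) :
    s * (s - 1) * ∫ v in Set.Ioi (0 : ℝ), (v : ℂ) ^ (s - 2) *
      (∑' z : StripDivisor f, (ordAt f z : ℝ) * (2 * Real.pi * max (z.1.im - v) 0) : ℝ) =
      2 * Real.pi * ∑' z : ℍ, (ordAt f z : ℂ) * stripPow s z := by
  have hs0 : s ≠ 0 := fun h => by simp [h] at hs; linarith
  have hs1 : s - 1 ≠ 0 := fun h => by
    rw [sub_eq_zero] at h
    simp [h] at hs
  have : Countable (StripDivisor f) :=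
    ((hf.countable_ordAt_ne_zero hf_inf).mono fun z hz => hz.2).to_subtype
  set G : StripDivisor f → ℝ → ℂ := fun z v =>
    (2 * Real.pi * ordAt f z : ℂ) * ((v : ℂ) ^ (s - 2) * (max (z.1.im - v) 0 : ℝ)) with hG
  have hGint : ∀ z, ∫ v in Set.Ioi (0 : ℝ), G z v =
      2 * Real.pi / (s * (s - 1)) * ((ordAt f z : ℂ) * stripPow s z) := by
    intro z
    rw [hG, integral_const_mul, integral_cpow_mul_max hs z.1.im_pos, stripPow,
      Set.indicator_of_mem z.2.1]
    ring
  have hGnorm : ∀ z, ∫ v in Set.Ioi (0 : ℝ), ‖G z v‖ =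
      2 * Real.pi / (s.re * (s.re - 1)) * ‖(ordAt f z : ℂ) * stripPow s z‖ := by
    intro z
    have h1 := integral_cpow_mul_max (s := s.re) (by simpa using hs) z.1.im_pos
    have h2 : Set.EqOn (fun v : ℝ => ((v : ℂ) ^ ((s.re : ℂ) - 2) * (max (z.1.im - v) 0 : ℝ)))
        (fun v : ℝ => ((v ^ (s.re - 2) * max (z.1.im - v) 0 : ℝ) : ℂ)) (Set.Ioi 0) := by
      intro v hv
      beta_reduce
      rw [Complex.ofReal_mul, Complex.ofReal_cpow (le_of_lt hv)]
      push_cast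
      rfl
    rw [setIntegral_congr_fun measurableSet_Ioi h2, integral_complex_ofReal,
      ← Complex.ofReal_cpow z.1.im_pos.le] at h1
    have h3 : ∫ v in Set.Ioi (0 : ℝ), v ^ (s.re - 2) * max (z.1.im - v) 0 =
        z.1.im ^ s.re / (s.re * (s.re - 1)) := by
      exact_mod_cast h1
    have h4 : Set.EqOn (fun v : ℝ => ‖G z v‖) (fun v => (2 * Real.pi * ‖(ordAt f z : ℂ)‖) *
        (v ^ (s.re - 2) * max (z.1.im - v) 0)) (Set.Ioi 0) := by
      intro v hv
      simp only [hG]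
      rw [norm_mul, norm_mul, norm_mul, norm_mul, Complex.norm_cpow_eq_rpow_re_of_pos hv,
        Complex.norm_of_nonneg (le_max_right _ _)]
      simp [abs_of_pos Real.pi_pos]
    rw [setIntegral_congr_fun measurableSet_Ioi h4, integral_const_mul, h3, norm_mul, stripPow,
      Set.indicator_of_mem z.2.1, Complex.norm_cpow_eq_rpow_re_of_pos z.1.im_pos]
    ring
  have hsum := hasSum_integral_of_summable_integral_norm (μ := volume.restrict (Set.Ioi 0))
    (F := G) (fun z => (integrableOn_cpow_mul_max hs z.1.im_pos).const_mul _) (by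
      simp_rw [hGnorm]
      exact ((hf.summable_ordAt_mul_stripPow hf_inf hs).norm.comp_injective
        injective_stripDivisor_val).mul_left _)
  have h5 : ∀ v : ℝ, ∑' z, G z v = (v : ℂ) ^ (s - 2) *
      (∑' z : StripDivisor f, (ordAt f z : ℝ) * (2 * Real.pi * max (z.1.im - v) 0) : ℝ) := by
    intro v
    rw [Complex.ofReal_tsum, ← tsum_mul_left]
    refine tsum_congr fun z => ?_
    simp only [hG]
    push_cast
    ring
  simp_rw [h5, hGint] at hsum
  rw [← hsum.tsum_eq, tsum_mul_left,
    injective_stripDivisor_val.tsum_eq (support_ordAt_mul_stripPow s)]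
  field_simp

lemma integral_eisenstein_of_one_lt_re (hf : IsMeromorphicModularForm 0 f)
    (hf_inf : Tendsto f atImInfty (𝓝 1)) (hF : IsFundamentalDomain modularAut F volume)
    {s : ℂ} (hs : 1 < s.re) :
    s * (1 - s) * ∫ τ in F, eisenstein τ s * (Real.log ‖f τ‖ : ℝ) =
      -2 * Real.pi * ∑ᶠ x : MulAction.orbitRel.Quotient SL(2, ℤ) ℍ,
        (ordAt f x.out : ℂ) / (omega x.out : ℂ) * eisenstein x.out s := by
  rw [hf.integral_eisenstein_mul hf_inf hF hs, hf.integral_stripPow_mul hf_inf hF hs,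
    ← hf.tsum_ordAt_mul_stripPow hf_inf hs]
  linear_combination -(hf.integral_tsum_stripDivisor hf_inf hs)

end IsMeromorphicModularForm

/-! ### Analytic continuation of the integral -/

/-- A pointwise limit of difference quotients, each measurable in τ. -/
lemma stronglyMeasurable_deriv_eisNum (s : ℂ) :
    StronglyMeasurable fun τ => deriv (eisNum τ) s := by
  refine stronglyMeasurable_of_tendsto (𝓝[≠] (0 : ℂ))
    (f := fun t τ => t⁻¹ • (eisNum τ (s + t) - eisNum τ s)) (fun t => ?_)
    (tendsto_pi_nhds.mpr fun τ => ?_)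
  · exact ((stronglyMeasurable_eisNum _).sub (stronglyMeasurable_eisNum s)).const_smul t⁻¹
  · exact hasDerivAt_iff_tendsto_slope_zero.mp (differentiable_eisNum τ s).hasDerivAt

namespace IsMeromorphicModularForm

variable {f : ℍ → ℂ} {F : Set ℍ}

lemma differentiable_integral_eisNum (hf : IsMeromorphicModularForm 0 f)
    (hf_inf : Tendsto f atImInfty (𝓝 1)) (hF : IsFundamentalDomain modularAut F volume) :
    Differentiable ℂ fun s => ∫ τ in F, eisNum τ s * (Real.log ‖f τ‖ : ℝ) := by
  intro s₀
  -- One unit for s in the ball around s₀, one for the Cauchy circle around s that bounds the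
  -- derivative.
  obtain ⟨C, k, hk, -, hC⟩ := exists_norm_eisNum_le (‖s₀‖ + 2)
  have hball : ∀ s ∈ Metric.ball s₀ 1, ∀ z ∈ Metric.sphere s 1, ‖z‖ ≤ ‖s₀‖ + 2 := by
    intro s hs z hz
    rw [mem_ball_iff_norm] at hs
    rw [mem_sphere_iff_norm] at hz
    have h1 : z = (z - s) + (s - s₀) + s₀ := by ring
    rw [h1]
    refine (norm_add₃_le).trans ?_
    linarith
  have hderiv : ∀ (τ : ℍ), ∀ s ∈ Metric.ball s₀ 1, ‖deriv (eisNum τ) s‖ ≤ C * pairSum τ k := by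
    intro τ s hs
    have h := Complex.norm_deriv_le_of_forall_mem_sphere_norm_le one_pos
      (differentiable_eisNum τ).diffContOnCl fun z hz => hC τ z (hball s hs z hz)
    rwa [div_one] at h
  have h0 : ∀ τ, ‖eisNum τ s₀‖ ≤ C * pairSum τ k := fun τ => hC τ s₀ (by linarith)
  have hl := (hf.aestronglyMeasurable_log_norm hf_inf).restrict (s := F)
  refine (hasDerivAt_integral_of_dominated_loc_of_deriv_le
    (F := fun s τ => eisNum τ s * (Real.log ‖f τ‖ : ℝ))
    (F' := fun s τ => deriv (eisNum τ) s * (Real.log ‖f τ‖ : ℝ))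
    (bound := fun τ => C * ‖pairSum τ k * Real.log ‖f τ‖‖)
    (Metric.ball_mem_nhds s₀ one_pos) (Eventually.of_forall fun s => ?_) ?_ ?_ ?_ ?_ ?_).2.differentiableAt
  · exact (stronglyMeasurable_eisNum s).aestronglyMeasurable.mul hl
  · exact hf.integrableOn_mul_log_norm hf_inf hF
      (stronglyMeasurable_eisNum s₀).aestronglyMeasurable hk h0
  · exact (stronglyMeasurable_deriv_eisNum s₀).aestronglyMeasurable.mul hl
  · refine ae_of_all _ fun τ s hs => ?_
    rw [norm_mul, norm_mul, Complex.norm_real, Real.norm_of_nonneg (pairSum_nonneg τ k), ← mul_assoc]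
    gcongr
    exact hderiv τ s hs
  · exact (hf.integrableOn_pairSum_mul hf_inf hF hk).norm.const_mul C
  · exact ae_of_all _ fun τ s _ => (differentiable_eisNum τ s).hasDerivAt.mul_const _

lemma finsum_ordAt_eq_sum (hf : IsMeromorphicModularForm 0 f)
    (hf_inf : Tendsto f atImInfty (𝓝 1)) (φ : ℍ → ℂ) :
    ∑ᶠ x : MulAction.orbitRel.Quotient SL(2, ℤ) ℍ,
        (ordAt f x.out : ℂ) / (omega x.out : ℂ) * φ x.out =
      ∑ x ∈ (hf.finite_orbits_ordAt_ne_zero hf_inf).toFinset,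
        (ordAt f x.out : ℂ) / (omega x.out : ℂ) * φ x.out := by
  refine finsum_eq_sum_of_support_subset _ fun x hx => ?_
  rw [Set.Finite.coe_toFinset]
  intro h0
  refine hx ?_
  beta_reduce
  rw [h0, Int.cast_zero, zero_div, zero_mul]

/-- Both sides are entire, the right one because only finitely many orbits contribute, and on Re s >
1 they are `eisDen s` times the unfolded identity. -/
lemma integral_eisNum (hf : IsMeromorphicModularForm 0 f)
    (hf_inf : Tendsto f atImInfty (𝓝 1)) (hF : IsFundamentalDomain modularAut F volume) (s : ℂ) :
    s * (1 - s) * ∫ τ in F, eisNum τ s * (Real.log ‖f τ‖ : ℝ) =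
      -2 * Real.pi * ∑ᶠ x : MulAction.orbitRel.Quotient SL(2, ℤ) ℍ,
        (ordAt f x.out : ℂ) / (omega x.out : ℂ) * eisNum x.out s := by
  have hJ := hf.differentiable_integral_eisNum hf_inf hF
  have hL : Differentiable ℂ fun s => s * (1 - s) *
      ∫ τ in F, eisNum τ s * (Real.log ‖f τ‖ : ℝ) := by fun_prop
  have hR : Differentiable ℂ fun s => -2 * (Real.pi : ℂ) *
      ∑ x ∈ (hf.finite_orbits_ordAt_ne_zero hf_inf).toFinset,
        (ordAt f x.out : ℂ) / (omega x.out : ℂ) * eisNum x.out s := by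
    refine (Differentiable.fun_sum fun x _ => ?_).const_mul _
    exact (differentiable_eisNum x.out).const_mul _
  have heq : ∀ s : ℂ, 1 < s.re → s * (1 - s) * ∫ τ in F, eisNum τ s * (Real.log ‖f τ‖ : ℝ) =
      -2 * (Real.pi : ℂ) * ∑ x ∈ (hf.finite_orbits_ordAt_ne_zero hf_inf).toFinset,
        (ordAt f x.out : ℂ) / (omega x.out : ℂ) * eisNum x.out s := by
    intro s hs
    have hD := eisDen_ne_zero hs
    have hN : ∀ τ, eisNum τ s = eisDen s * eisenstein τ s := fun τ => by
      rw [eisenstein_eq_div τ hD, mul_div_cancel₀ _ hD]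
    have h := hf.integral_eisenstein_of_one_lt_re hf_inf hF hs
    rw [hf.finsum_ordAt_eq_sum hf_inf fun τ => eisenstein τ s] at h
    simp_rw [hN, mul_left_comm _ (eisDen s), mul_assoc (eisDen s)]
    rw [integral_const_mul, ← Finset.mul_sum]
    linear_combination eisDen s * h
  rw [hf.finsum_ordAt_eq_sum hf_inf fun τ => eisNum τ s]
  refine AnalyticOnNhd.eqOn_of_preconnected_of_eventuallyEq (z₀ := 2)
    (fun z _ => hL.analyticAt z) (fun z _ => hR.analyticAt z) isPreconnected_univ
    (Set.mem_univ _) ?_ (Set.mem_univ s)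
  filter_upwards [isOpen_one_lt_re.mem_nhds (by simp : (2 : ℂ) ∈ {s : ℂ | 1 < s.re})] with z hz
  exact heq z hz

lemma integral_eisenstein_of_eisDen_ne_zero (hf : IsMeromorphicModularForm 0 f)
    (hf_inf : Tendsto f atImInfty (𝓝 1)) (hF : IsFundamentalDomain modularAut F volume) {s : ℂ}
    (hs : eisDen s ≠ 0) :
    s * (1 - s) * ∫ τ in F, eisenstein τ s * (Real.log ‖f τ‖ : ℝ) =
      -2 * Real.pi * ∑ᶠ x : MulAction.orbitRel.Quotient SL(2, ℤ) ℍ,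
        (ordAt f x.out : ℂ) / (omega x.out : ℂ) * eisenstein x.out s := by
  have h := hf.integral_eisNum hf_inf hF s
  rw [hf.finsum_ordAt_eq_sum hf_inf fun τ => eisNum τ s] at h
  rw [hf.finsum_ordAt_eq_sum hf_inf fun τ => eisenstein τ s]
  have hN : ∀ τ, eisNum τ s = eisDen s * eisenstein τ s := fun τ => by
    rw [eisenstein_eq_div τ hs, mul_div_cancel₀ _ hs]
  simp_rw [hN, mul_left_comm _ (eisDen s), mul_assoc (eisDen s)] at h
  rw [integral_const_mul, ← Finset.mul_sum] at h
  refine mul_left_cancel₀ hs ?_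
  linear_combination h

end IsMeromorphicModularForm

/-! ### Points at which all Eisenstein series are holomorphic -/

lemma analyticAt_eisenstein (τ : ℍ) {s : ℂ} (hs : eisDen s ≠ 0) :
    AnalyticAt ℂ (eisenstein τ) s := by
  have h : (fun z => eisNum τ z / eisDen z) =ᶠ[𝓝 s] eisenstein τ := by
    filter_upwards [differentiable_eisDen.continuous.continuousAt.eventually_ne hs] with z hz
    exact (eisenstein_eq_div τ hz).symm
  exact (((differentiable_eisNum τ).analyticAt s).div (differentiable_eisDen.analyticAt s) hs).congr h

/-- Near a point at which all Eisenstein series are holomorphic they are dominated, uniformly in `s`,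
by a pair sum. -/
lemma exists_norm_eisenstein_le_of_analyticAt {s₀ : ℂ}
    (hs₀ : ∀ τ : ℍ, AnalyticAt ℂ (eisenstein τ) s₀) :
    ∃ (C : ℝ) (k : ℕ), 2 ≤ k ∧ ∀ᶠ s in 𝓝 s₀, ∀ τ : ℍ, ‖eisenstein τ s‖ ≤ C * pairSum τ k := by
  obtain ⟨r, hr, hball⟩ := (nhdsWithin_hasBasis Metric.nhds_basis_closedBall {s₀}ᶜ).eventually_iff.mp
    (eventually_eisDen_ne_zero s₀)
  obtain ⟨C, k, hk, hC0, hC⟩ := exists_norm_eisNum_le (‖s₀‖ + r)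
  have hne : ∀ z ∈ Metric.sphere s₀ r, eisDen z ≠ 0 := fun z hz =>
    hball ⟨Metric.sphere_subset_closedBall hz, fun h => by
      rw [Set.mem_singleton_iff.mp h, mem_sphere_iff_norm, sub_self, norm_zero] at hz
      exact hr.ne hz⟩
  obtain ⟨z₀, hz₀, hmin⟩ := (isCompact_sphere s₀ r).exists_isMinOn
    (NormedSpace.sphere_nonempty.mpr hr.le) differentiable_eisDen.continuous.norm.continuousOn
  have hm : 0 < ‖eisDen z₀‖ := norm_pos_iff.mpr (hne z₀ hz₀)
  refine ⟨C / ‖eisDen z₀‖, k, hk, ?_⟩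
  filter_upwards [Metric.closedBall_mem_nhds s₀ hr] with s hs τ
  have hd : DifferentiableOn ℂ (eisenstein τ) (Metric.closedBall s₀ r) := fun z hz => by
    rcases eq_or_ne z s₀ with rfl | h
    · exact (hs₀ τ).differentiableAt.differentiableWithinAt
    · exact (analyticAt_eisenstein τ (hball ⟨hz, h⟩)).differentiableAt.differentiableWithinAt
  -- Maximum principle: on the circle `eisDen` is bounded away from zero, and E is holomorphic in
  -- the disc even if `eisDen` vanishes at the centre.
  refine Complex.norm_le_of_forall_mem_frontier_norm_le (U := Metric.ball s₀ r)
    Metric.isBounded_ball (hd.diffContOnCl_ball subset_rfl) (fun z hz => ?_) ?_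
  · rw [frontier_ball _ hr.ne'] at hz
    rw [eisenstein_eq_div τ (hne z hz), norm_div, div_mul_eq_mul_div]
    have h1 : ‖eisDen z₀‖ ≤ ‖eisDen z‖ := hmin hz
    have h2 : ‖z‖ ≤ ‖s₀‖ + r := by
      rw [mem_sphere_iff_norm] at hz
      have := norm_le_norm_add_norm_sub' z s₀
      linarith
    have h3 := pairSum_nonneg τ k
    have h4 := hC τ z h2
    gcongr
  · rwa [closure_ball _ hr.ne']

lemma stronglyMeasurable_eisenstein_of_analyticAt {s₀ : ℂ}
    (hs₀ : ∀ τ : ℍ, AnalyticAt ℂ (eisenstein τ) s₀) :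
    StronglyMeasurable fun τ => eisenstein τ s₀ := by
  refine stronglyMeasurable_of_tendsto (𝓝[≠] s₀) (f := fun s τ => eisNum τ s * (eisDen s)⁻¹)
    (fun s => (stronglyMeasurable_eisNum s).mul_const _) (tendsto_pi_nhds.mpr fun τ => ?_)
  refine ((hs₀ τ).continuousAt.tendsto.mono_left nhdsWithin_le_nhds).congr' ?_
  filter_upwards [eventually_eisDen_ne_zero s₀] with s hs
  rw [eisenstein_eq_div τ hs, div_eq_mul_inv]

namespace IsMeromorphicModularForm

variable {f : ℍ → ℂ} {F : Set ℍ}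

lemma integrableOn_eisenstein_of_analyticAt (hf : IsMeromorphicModularForm 0 f)
    (hf_inf : Tendsto f atImInfty (𝓝 1)) (hF : IsFundamentalDomain modularAut F volume) {s₀ : ℂ}
    (hs₀ : ∀ τ : ℍ, AnalyticAt ℂ (eisenstein τ) s₀) :
    IntegrableOn (fun τ => eisenstein τ s₀ * (Real.log ‖f τ‖ : ℝ)) F := by
  obtain ⟨C, k, hk, h⟩ := exists_norm_eisenstein_le_of_analyticAt hs₀
  exact hf.integrableOn_mul_log_norm hf_inf hF
    (stronglyMeasurable_eisenstein_of_analyticAt hs₀).aestronglyMeasurable hk h.self_of_nhds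

/-- `eisDen` may vanish at s₀, but its zeros are isolated: the identity holds at nearby s ≠ s₀ and
passes to the limit by dominated convergence. -/
lemma integral_eisenstein_of_analyticAt (hf : IsMeromorphicModularForm 0 f)
    (hf_inf : Tendsto f atImInfty (𝓝 1)) (hF : IsFundamentalDomain modularAut F volume) {s₀ : ℂ}
    (hs₀ : ∀ τ : ℍ, AnalyticAt ℂ (eisenstein τ) s₀) :
    s₀ * (1 - s₀) * ∫ τ in F, eisenstein τ s₀ * (Real.log ‖f τ‖ : ℝ) =
      -2 * Real.pi * ∑ᶠ x : MulAction.orbitRel.Quotient SL(2, ℤ) ℍ,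
        (ordAt f x.out : ℂ) / (omega x.out : ℂ) * eisenstein x.out s₀ := by
  obtain ⟨C, k, hk, hC⟩ := exists_norm_eisenstein_le_of_analyticAt hs₀
  have hlim : ∀ τ : ℍ, Tendsto (eisenstein τ) (𝓝[≠] s₀) (𝓝 (eisenstein τ s₀)) := fun τ =>
    (hs₀ τ).continuousAt.tendsto.mono_left nhdsWithin_le_nhds
  have hid : Tendsto (fun s : ℂ => s * (1 - s)) (𝓝[≠] s₀) (𝓝 (s₀ * (1 - s₀))) :=
    ((continuous_id.mul (continuous_const.sub continuous_id)).tendsto s₀).mono_left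
      nhdsWithin_le_nhds
  have hint : Tendsto (fun s => ∫ τ in F, eisenstein τ s * (Real.log ‖f τ‖ : ℝ)) (𝓝[≠] s₀)
      (𝓝 (∫ τ in F, eisenstein τ s₀ * (Real.log ‖f τ‖ : ℝ))) := by
    refine tendsto_integral_filter_of_dominated_convergence
      (fun τ => C * ‖pairSum τ k * Real.log ‖f τ‖‖) ?_ ?_
      ((hf.integrableOn_pairSum_mul hf_inf hF hk).norm.const_mul C)
      (ae_of_all _ fun τ => (hlim τ).mul_const _)
    · filter_upwards [eventually_eisDen_ne_zero s₀] with s hs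
      exact (stronglyMeasurable_eisenstein hs).aestronglyMeasurable.mul
        (hf.aestronglyMeasurable_log_norm hf_inf).restrict
    · filter_upwards [hC.filter_mono nhdsWithin_le_nhds] with s hs
      refine ae_of_all _ fun τ => ?_
      rw [norm_mul, norm_mul, Complex.norm_real, Real.norm_of_nonneg (pairSum_nonneg τ k),
        ← mul_assoc]
      gcongr
      exact hs τ
  have hsum : Tendsto (fun s => -2 * (Real.pi : ℂ) *
      ∑ x ∈ (hf.finite_orbits_ordAt_ne_zero hf_inf).toFinset,
        (ordAt f x.out : ℂ) / (omega x.out : ℂ) * eisenstein x.out s) (𝓝[≠] s₀)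
      (𝓝 (-2 * (Real.pi : ℂ) * ∑ x ∈ (hf.finite_orbits_ordAt_ne_zero hf_inf).toFinset,
        (ordAt f x.out : ℂ) / (omega x.out : ℂ) * eisenstein x.out s₀)) :=
    (tendsto_finsetSum _ fun x _ => (hlim x.out).const_mul _).const_mul _
  rw [hf.finsum_ordAt_eq_sum hf_inf fun τ => eisenstein τ s₀]
  refine tendsto_nhds_unique ((hid.mul hint).congr' ?_) hsum
  filter_upwards [eventually_eisDen_ne_zero s₀] with s hs
  rw [hf.integral_eisenstein_of_eisDen_ne_zero hf_inf hF hs,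
    hf.finsum_ordAt_eq_sum hf_inf fun τ => eisenstein τ s]

end IsMeromorphicModularForm

/-! ### The regularized inner product -/

lemma volume_singleton_eq_zero (z : ℍ) : volume ({z} : Set ℍ) = 0 := by
  have hsub : ({z} : Set ℍ) ⊆ rect {z.re} {z.im} := by
    rintro _ rfl
    exact ⟨rfl, rfl⟩
  refine measure_mono_null hsub ?_
  have h := setLIntegral_rect (measurableSet_singleton z.re) (measurableSet_singleton z.im)
    (Set.singleton_subset_iff.mpr z.im_pos) (φ := fun _ => 1) measurable_const
  rw [setLIntegral_one] at h
  rw [h]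
  exact setLIntegral_measure_zero _ _ Real.volume_singleton

lemma isOpen_cuspNhd (ρ : OnePoint ℚ) (y : ℝ) : IsOpen (cuspNhd ρ y) := by
  have : cuspNhd ρ y = ⋃ (σ : SL(2, ℤ))
      (_ : Matrix.SpecialLinearGroup.mapGL ℚ σ • (∞ : OnePoint ℚ) = ρ),
      {τ : ℍ | y < (σ⁻¹ • τ).im} := by
    ext τ
    simp [cuspNhd]
  rw [this]
  exact isOpen_iUnion fun σ => isOpen_iUnion fun _ =>
    isOpen_lt continuous_const (continuous_im.comp (continuous_const_smul σ⁻¹))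

/-- The imaginary part attains a maximum on the orbit of τ; above this height τ lies in no
neighbourhood of any cusp. -/
lemma exists_forall_notMem_cuspNhd (τ : ℍ) : ∃ Y : ℝ, ∀ y, Y ≤ y → ∀ ρ, τ ∉ cuspNhd ρ y := by
  obtain ⟨γ, hγ⟩ := ModularGroup.exists_max_im τ
  refine ⟨(γ • τ).im, fun y hy ρ ⟨σ, _, hσ⟩ => ?_⟩
  exact absurd (hγ σ⁻¹) (not_le.mpr (hy.trans_lt hσ))

lemma tendsto_setIntegral_of_eventually_mem_iff {ι : Type*} {l : Filter ι} [l.IsCountablyGenerated]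
    {A : ι → Set ℍ} {B F : Set ℍ} {φ : ℍ → ℂ} (hF : MeasurableSet F) (hφ : IntegrableOn φ F)
    (hA : ∀ i, MeasurableSet (A i)) (hAF : ∀ i, A i ⊆ F) (hB : MeasurableSet B) (hBF : B ⊆ F)
    (h : ∀ᵐ τ, τ ∈ F → ∀ᶠ i in l, (τ ∈ A i ↔ τ ∈ B)) :
    Tendsto (fun i => ∫ τ in A i, φ τ) l (𝓝 (∫ τ in B, φ τ)) := by
  have key : ∀ D : Set ℍ, MeasurableSet D → D ⊆ F →
      ∫ τ in D, φ τ = ∫ τ in F, D.indicator φ τ := fun D hD hDF => by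
    rw [setIntegral_indicator hD, Set.inter_eq_right.mpr hDF]
  simp_rw [fun i => key (A i) (hA i) (hAF i), key B hB hBF]
  refine tendsto_integral_filter_of_dominated_convergence (fun τ => ‖φ τ‖)
    (Eventually.of_forall fun i => hφ.aestronglyMeasurable.indicator (hA i))
    (Eventually.of_forall fun i => ae_of_all _ fun τ => norm_indicator_le_norm_self _ _) hφ.norm ?_
  rw [ae_restrict_iff' hF]
  filter_upwards [h] with τ hτ hτF
  refine tendsto_const_nhds.congr' ?_
  filter_upwards [hτ hτF] with i hi
  by_cases hτB : τ ∈ B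
  · rw [Set.indicator_of_mem hτB, Set.indicator_of_mem (hi.mpr hτB)]
  · rw [Set.indicator_of_notMem hτB, Set.indicator_of_notMem fun h => hτB (hi.mp h)]

lemma isOpen_iUnion_disc (S : Set ℍ) (ε : ℝ) :
    IsOpen (⋃ z ∈ S, {τ : ℍ | ‖(τ : ℂ) - (z : ℂ)‖ < ε}) :=
  isOpen_biUnion fun _ _ => isOpen_lt (continuous_coe.sub continuous_const).norm continuous_const

/-- For an integrable function both limits are dominated convergence: each point eventually leaves
the cusp neighbourhoods, and each point outside the null set S eventually leaves the discs. The
hypothesis on distances makes this work for infinitely many discs at once. -/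
lemma hasRegInner_of_integrableOn {F S : Set ℍ} {f g : ℍ → ℂ} (hF : IsClosed F) (hS : S.Countable)
    (hSd : ∀ τ ∉ S, ∃ δ > 0, ∀ z ∈ S, δ ≤ ‖(τ : ℂ) - (z : ℂ)‖)
    (h : IntegrableOn (fun τ => f τ * starRingEnd ℂ (g τ)) F) :
    HasRegInner F S f g (∫ τ in F, f τ * starRingEnd ℂ (g τ)) := by
  have hFm := hF.measurableSet
  have hD : ∀ ε : ℝ, MeasurableSet (F \ ⋃ z ∈ S ∩ F, {τ : ℍ | ‖(τ : ℂ) - (z : ℂ)‖ < ε}) :=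
    fun ε => hFm.diff (isOpen_iUnion_disc (S ∩ F) ε).measurableSet
  refine ⟨fun ε => ∫ τ in F \ ⋃ z ∈ S ∩ F, {τ : ℍ | ‖(τ : ℂ) - (z : ℂ)‖ < ε},
    f τ * starRingEnd ℂ (g τ), Eventually.of_forall fun ε => ⟨?_, ?_⟩, ?_⟩
  · exact Eventually.of_forall fun y => h.mono_set Set.sdiff_subset
  · refine tendsto_setIntegral_of_eventually_mem_iff hFm h (fun y => ?_) (fun y => Set.sdiff_subset)
      (hD ε) Set.sdiff_subset (ae_of_all _ fun τ hτ => ?_)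
    · exact hFm.diff ((isOpen_iUnion_disc (S ∩ F) ε).union
        (isOpen_biUnion fun ρ _ => isOpen_cuspNhd ρ y)).measurableSet
    · obtain ⟨Y, hY⟩ := exists_forall_notMem_cuspNhd τ
      filter_upwards [eventually_ge_atTop Y] with y hy
      have hn : τ ∉ ⋃ ρ ∈ cuspsOf F, cuspNhd ρ y := by
        simp only [Set.mem_iUnion, not_exists]
        exact fun ρ _ => hY y hy ρ
      rw [puncturedDomain, Set.mem_sdiff, Set.mem_sdiff, Set.mem_union, or_iff_left hn]
  · refine tendsto_setIntegral_of_eventually_mem_iff hFm h hD (fun ε => Set.sdiff_subset) hFm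
      subset_rfl ?_
    have hS0 : ∀ᵐ τ : ℍ, τ ∉ S := by
      rw [ae_iff]
      simp only [not_not]
      change volume S = 0
      rw [← Set.biUnion_of_singleton S, measure_biUnion_null_iff hS]
      exact fun z _ => volume_singleton_eq_zero z
    filter_upwards [hS0] with τ hτS hτ
    obtain ⟨δ, hδ, hSδ⟩ := hSd τ hτS
    filter_upwards [nhdsWithin_le_nhds (gt_mem_nhds hδ)] with ε hε
    refine ⟨fun h => h.1, fun h => ⟨h, ?_⟩⟩
    simp only [Set.mem_iUnion, not_exists]
    intro z hz hzτ
    exact absurd (hSδ z hz.1) (not_le.mpr (lt_trans hzτ hε))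

/-- Zeros and poles are isolated: on a punctured disc around τ, f is analytic and nonzero. -/
lemma IsMeromorphicModularForm.exists_forall_le_norm_sub {f : ℍ → ℂ}
    (hf : IsMeromorphicModularForm 0 f) (hf_inf : Tendsto f atImInfty (𝓝 1)) {τ : ℍ}
    (hτ : ordAt f τ = 0) :
    ∃ δ > 0, ∀ z : ℍ, ordAt f z ≠ 0 → δ ≤ ‖(τ : ℂ) - (z : ℂ)‖ := by
  have hm := hf.meromorphicOn τ τ.im_pos
  have h1 : ∀ᶠ z in 𝓝[≠] (τ : ℂ), (f ∘ ofComplex) z ≠ 0 :=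
    hm.eventually_eq_zero_or_eventually_ne_zero.resolve_left fun h =>
      hf.meromorphicOrderAt_ne_top hf_inf τ (meromorphicOrderAt_eq_top_iff.mpr h)
  obtain ⟨δ, hδ, hball⟩ := Metric.eventually_nhds_iff_ball.mp
    (eventually_nhdsWithin_iff.mp (h1.and hm.eventually_analyticAt))
  refine ⟨δ, hδ, fun z hz => ?_⟩
  by_contra! hlt
  rcases eq_or_ne (z : ℂ) τ with h | h
  · rw [UpperHalfPlane.coe_injective h] at hz
    exact hz hτ
  · obtain ⟨h2, h3⟩ := hball z (by rwa [Metric.mem_ball, dist_comm, dist_eq_norm]) h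
    refine hz ?_
    rw [ordAt, h3.meromorphicOrderAt_eq, analyticOrderAt_eq_zero.mpr (Or.inr h2)]
    simp

end EisensteinDivisorSum

end

theorem mainTheorem6 (f : ℍ → ℂ)
    (hf : EisensteinDivisorSum.IsMeromorphicModularForm 0 f)
    (hf_inf : Tendsto f atImInfty (𝓝 1))
    (F : Set ℍ) (hF : EisensteinDivisorSum.IsClosedFundamentalDomain F)
    (s : ℂ)
    (hs : 1 < s.re ∨ ∀ τ : ℍ, AnalyticAt ℂ (EisensteinDivisorSum.eisenstein τ) s) :
    {x : MulAction.orbitRel.Quotient SL(2, ℤ) ℍ |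
        EisensteinDivisorSum.ordAt f x.out ≠ 0}.Finite ∧
    ∃ L : ℂ,
      EisensteinDivisorSum.HasRegInner F {z : ℍ | EisensteinDivisorSum.ordAt f z ≠ 0}
        (fun τ => EisensteinDivisorSum.eisenstein τ s)
        (fun τ => ((Real.log ‖f τ‖ : ℝ) : ℂ)) L ∧
      s * (1 - s) * L =
        -2 * (Real.pi : ℂ) * ∑ᶠ x : MulAction.orbitRel.Quotient SL(2, ℤ) ℍ,
          ((EisensteinDivisorSum.ordAt f x.out : ℤ) : ℂ) /
              ((EisensteinDivisorSum.omega x.out : ℕ) : ℂ) *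
            EisensteinDivisorSum.eisenstein x.out s := by
  -- The half-plane Re s > 1 is a case of the second alternative, as `eisDen` has no zeros there.
  have hs' : ∀ τ : ℍ, AnalyticAt ℂ (EisensteinDivisorSum.eisenstein τ) s := hs.elim
    (fun h τ => EisensteinDivisorSum.analyticAt_eisenstein τ
      (EisensteinDivisorSum.eisDen_ne_zero h)) id
  have hF' := hF.isFundamentalDomain
  have hint := hf.integrableOn_eisenstein_of_analyticAt hf_inf hF' hs'
  refine ⟨hf.finite_orbits_ordAt_ne_zero hf_inf, _,
    EisensteinDivisorSum.hasRegInner_of_integrableOn hF.isClosed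
      (hf.countable_ordAt_ne_zero hf_inf)
      (fun τ hτ => hf.exists_forall_le_norm_sub hf_inf (not_not.mp hτ)) ?_, ?_⟩
  · simpa only [Complex.conj_ofReal] using hint
  · simp only [Complex.conj_ofReal]
    exact hf.integral_eisenstein_of_analyticAt hf_inf hF' hs'
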